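/- Let $p$ be a prime, let $K$ be a finite extension of $\mathbb{Q}_p$ with ring of integers $\mathfrak{o}_v$, residue field $k_v$ and ramification index $e$ over $\mathbb{Q}_p$. Let $\mathcal{X}$ be a smooth $\mathfrak{o}_v$-scheme whose generic fiber $X=\mathcal{X}\times_{\mathfrak{o}_v}K$ has (Krull) dimension $g$, with special fiber $\overline{\mathcal{X}}=\mathcal{X}\times_{\mathfrak{o}_v}k_v$, and let $\Phi:\mathcal{X}\to\mathcal{X}$ be an étale endomorphism of $\mathfrak{o}_v$-schemes. Let $\mathcal{Y}$ be a subvariety of $\mathcal{X}$, that is, an integral closed subscheme, and assume that there is a point in $\mathcal{Y}(\mathfrak{o}_v)$ whose associated $K$-point is a smooth point of the generic fiber $\mathcal{Y}\times_{\mathfrak{o}_v}K$ over $K$. For $n\ge 0$ let $\mathcal{Y}_n$ be the Zariski closure of $\Phi^n(\mathcal{Y})$ in $\mathcal{X}$. Call $\mathcal{Y}$ preperiodic if $\mathcal{Y}_{\ell+N}=\mathcal{Y}_{\ell}$ for some $\ell\ge 0$ and $N\ge 1$, and let the length of its orbit be the number of distinct members of $\{\mathcal{Y}_n : n\ge 0\}$.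 If $\mathcal{Y}$ is preperiodic under $\Phi$, then the length of its orbit is at most $$p^{1+r}\cdot \#\mathrm{GL}_g(k_v)\cdot \#\overline{\mathcal{X}}(k_v),$$ where $r$ is the smallest nonnegative integer with $r>(\log e-\log(p-1))/\log 2$. (If $\mathcal{X}$ is not of finite type and $\overline{\mathcal{X}}(k_v)$ is infinite, the bound is $\infty$.) -/

import Mathlib

open AlgebraicGeometry CategoryTheory Limits

universe u

namespace PadicOrbit

/-! ### The ring of integers of a finite extension of `ℚ_[p]` is a local ring -/

section RingOfIntegers

variable (p : ℕ) [Fact p.Prime] (K : Type u) [Field K] [Algebra ℚ_[p] K]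
  [FiniteDimensional ℚ_[p] K] [Algebra ℤ_[p] K] [IsScalarTower ℤ_[p] ℚ_[p] K]

/-- An element of `K` is integral over `ℤ_[p]` if and only if its `p`-adic absolute value (the
unique extension to `K` of the absolute value of `ℚ_[p]`) is at most `1`. -/
theorem mem_ringOfIntegers_iff (x : K) :
    x ∈ integralClosure ℤ_[p] K ↔ spectralNorm ℚ_[p] K x ≤ 1 := by
  have hint : IsIntegral ℚ_[p] x := Algebra.IsIntegral.isIntegral x
  have hmon : (minpoly ℚ_[p] x).Monic := minpoly.monic hint
  rw [spectralNorm, spectralValue_le_one_iff hmon, _root_.mem_integralClosure_iff]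
  constructor
  · intro hx n
    rw [minpoly.isIntegrallyClosed_eq_field_fractions' ℚ_[p] hx, Polynomial.coeff_map]
    exact PadicInt.norm_le_one _
  · intro h
    have hl : minpoly ℚ_[p] x ∈ Polynomial.lifts (algebraMap ℤ_[p] ℚ_[p]) := by
      rw [Polynomial.lifts_iff_coeff_lifts]
      intro n
      exact ⟨⟨_, h n⟩, rfl⟩
    obtain ⟨q, hq, -, hqm⟩ := Polynomial.lifts_and_natDegree_eq_and_monic hl hmon
    refine ⟨q, hqm, ?_⟩
    rw [IsScalarTower.algebraMap_eq ℤ_[p] ℚ_[p] K, ← Polynomial.eval₂_map, hq]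
    exact minpoly.aeval ℚ_[p] x

instance isLocalRing_integralClosure : IsLocalRing (integralClosure ℤ_[p] K) := by
  have hmul : ∀ x y : K, spectralNorm ℚ_[p] K (x * y)
      = spectralNorm ℚ_[p] K x * spectralNorm ℚ_[p] K y := fun x y =>
    spectralAlgNorm_mul (K := ℚ_[p]) (L := K) x y
  have hunit : ∀ x : integralClosure ℤ_[p] K,
      x ∈ nonunits (integralClosure ℤ_[p] K) ↔ spectralNorm ℚ_[p] K (x : K) < 1 := by
    intro x
    have hx := (mem_ringOfIntegers_iff p K (x : K)).1 x.2
    rw [mem_nonunits_iff]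
    constructor
    · intro h
      refine lt_of_le_of_ne hx fun h1 => h ?_
      have hx0 : (x : K) ≠ 0 := by
        intro h0
        rw [h0, spectralNorm_zero] at h1
        exact zero_ne_one h1
      have hinv : spectralNorm ℚ_[p] K (x : K)⁻¹ = 1 := by
        have := hmul (x : K) (x : K)⁻¹
        rw [mul_inv_cancel₀ hx0, spectralNorm_one, h1, one_mul] at this
        exact this.symm
      refine IsUnit.of_mul_eq_one ⟨(x : K)⁻¹, (mem_ringOfIntegers_iff p K _).2 hinv.le⟩ ?_
      exact Subtype.ext (mul_inv_cancel₀ hx0)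
    · rintro h ⟨v, rfl⟩
      have h2 := (mem_ringOfIntegers_iff p K _).1 (↑v⁻¹ : integralClosure ℤ_[p] K).2
      have h3 := hmul ((v : integralClosure ℤ_[p] K) : K) ((↑v⁻¹ : integralClosure ℤ_[p] K) : K)
      rw [← MulMemClass.coe_mul, Units.mul_inv, OneMemClass.coe_one, spectralNorm_one] at h3
      have h4 := spectralNorm_nonneg (K := ℚ_[p]) ((v : integralClosure ℤ_[p] K) : K)
      nlinarith
  refine IsLocalRing.of_nonunits_add fun a b ha hb => ?_
  rw [hunit] at ha hb ⊢
  exact lt_of_le_of_lt (isNonarchimedean_spectralNorm (K := ℚ_[p]) (L := K) (a : K) (b : K))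
    (max_lt ha hb)

end RingOfIntegers

/-! ### Fibers and points of schemes over a ring -/

noncomputable section Fibers

variable {R : Type u} [CommRing R] {X : Scheme.{u}}

/-- The generic fiber `X ×_{Spec R} Spec K` of an `R`-scheme `X`, where `K` is a field over `R`
(in the application, the fraction field of `R`). -/
abbrev genericFiber (K : Type u) [Field K] [Algebra R K] (f : X ⟶ Spec (.of R)) : Scheme.{u} :=
  pullback f (Spec.map (CommRingCat.ofHom (algebraMap R K)))

/-- The structure morphism of the generic fiber. -/
abbrev genericFiberMap (K : Type u) [Field K] [Algebra R K] (f : X ⟶ Spec (.of R)) :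
    genericFiber K f ⟶ Spec (.of K) :=
  pullback.snd f (Spec.map (CommRingCat.ofHom (algebraMap R K)))

/-- The `K`-point of the generic fiber of `X` obtained by base change from an `R`-point of `X`. -/
def genericSection (K : Type u) [Field K] [Algebra R K] (f : X ⟶ Spec (.of R))
    (s : Spec (.of R) ⟶ X) (hs : s ≫ f = 𝟙 _) : Spec (.of K) ⟶ genericFiber K f :=
  pullback.lift (Spec.map (CommRingCat.ofHom (algebraMap R K)) ≫ s) (𝟙 _) (by simp [hs])

/-- The point of the generic fiber of `X` in which an `R`-point of `X` meets it. -/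
def genericPointOf (K : Type u) [Field K] [Algebra R K] (f : X ⟶ Spec (.of R))
    (s : Spec (.of R) ⟶ X) (hs : s ≫ f = 𝟙 _) : genericFiber K f :=
  genericSection K f s hs (IsLocalRing.closedPoint K)

/-- The special fiber of a scheme over a local ring `R`. -/
abbrev specialFiber [IsLocalRing R] (f : X ⟶ Spec (.of R)) : Scheme.{u} :=
  pullback f (Spec.map (CommRingCat.ofHom (IsLocalRing.residue R)))

/-- The set of points of the special fiber that are rational over the residue field `k` of `R`,
that is, of morphisms of `k`-schemes from `Spec k` to the special fiber. -/
def SpecialFiberPoints [IsLocalRing R] (f : X ⟶ Spec (.of R)) : Type u :=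
  {s : Spec (.of (IsLocalRing.ResidueField R)) ⟶ specialFiber f //
    s ≫ pullback.snd f (Spec.map (CommRingCat.ofHom (IsLocalRing.residue R))) = 𝟙 _}

/-- A morphism of schemes is smooth at the point `x` of its source if its restriction to some
open neighbourhood of `x` is smooth. -/
def SmoothAt {Y : Scheme.{u}} (f : X ⟶ Y) (x : X) : Prop :=
  ∃ U : X.Opens, x ∈ U ∧ AlgebraicGeometry.Smooth (U.ι ≫ f)

end Fibers

/-! ### Orbits of subvarieties -/

section Orbits

variable {X : Scheme.{u}}

/-- The `n`-th iterate of a subset `Y` under an endomorphism `Φ` of `X`, as a closed subset of `X`: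
the Zariski closure of `Φⁿ(Y)`. -/
def iterImage (Φ : X ⟶ X) (Y : Set X) (n : ℕ) : Set X :=
  closure ((fun x : X => Φ x)^[n] '' Y)

/-- `Y` is preperiodic under `Φ`: its `(ℓ + N)`-th iterate equals its `ℓ`-th iterate, for some
`ℓ ≥ 0` and `N ≥ 1`. -/
def IsPreperiodic (Φ : X ⟶ X) (Y : Set X) : Prop :=
  ∃ ℓ N : ℕ, 0 < N ∧ iterImage Φ Y (ℓ + N) = iterImage Φ Y ℓ

/-- The length of the orbit of `Y` under `Φ`: the number of distinct iterates of `Y`. -/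
noncomputable def orbitLength (Φ : X ⟶ X) (Y : Set X) : ℕ∞ :=
  (Set.range (iterImage Φ Y)).encard

end Orbits

end PadicOrbit

/-!
The proof is `p`-adic: an orbit is interpolated in time by a `p`-adic analytic function, so that it
cannot return to a closed set infinitely often without staying in it.

Write `o` for the ring of integers, `k` for its residue field, and let `x_n` be the reduction of
`Φⁿ(β)`. By the pigeonhole principle there are `a` and `b ≥ 1` with `a + b ≤ #X̄(k)` and
`x_{a+b} = x_a`, so that `Ψ = Φᵇ` fixes the closed point `x = x_a`. Let `A` be the local ring of `X`
at `x`, with maximal ideal `m`, and `ψ` the endomorphism of the `o`-algebra `A` induced by `Ψ`.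

*Interpolation.* The ideal `m` is generated by that of `o` and at most `g` further elements
(`exists_generators_maximalIdeal_stalk`), and `ψ(m)` generates `m` because `Ψ` is unramified
(`exists_stalk_endomorphism`). Hence some power `ψ^N`, with `N ≤ #GL_g(k)`, is the identity on
`m / (m² + m_o A)` (`exists_pow_sub_mem`). A first `p`-th power makes it the identity on `m / m²`
(`pow_prime_sub_mem_sq`), and `r` further ones give an endomorphism `T` with
`(T - 1) mⁱ ⊆ m^(i + s)` for some `s > e / (p - 1)` (`IsShift.exists_pow_prime_pow`). For an
integral point `ζ : A → o` the Newton expansion `ζ(Tⁿ a) = ∑ (n choose j) ζ((T - 1)ʲ a)` then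
converges fast enough to be an analytic function of `n ∈ ℤ_p`. By Strassmann's theorem it vanishes
identically if it vanishes for infinitely many `n`
(`sum_descFactorial_eq_zero_of_infinite`, `IsShift.eval_pow_eq_zero_of_infinite`). So with
`M = b N p^(1 + r)`, the sequence `n ↦ Φ^(a + M n)(y)` stays in every closed set that it meets
infinitely often, for every integral point `y` with the reduction of `β`
(`exists_pow_forall_return`).

*Density.* The generic points of the integral points of `Y` with the reduction of `β` are dense in
`Y`: near `β` the generic fiber of `Y` is étale over an affine space, and the inverse function
theorem provides enough points (`exists_integral_point`, `exists_section_mem_open`).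

*Conclusion.* Let `η` be the generic point of `Y`. As `Y` is preperiodic, `ω = Φ^(a + M n)(η)` is
the same point for infinitely many `n`, so that the closure of `ω` contains `Φ^(a + M n)(y)` first
for those `n` and then for all `n`; by density it contains `Φ^(a + M n)(η)` for all `n`. The point
`ω` and its specialization `Φᵃ(η)` have the same image under an iterate of `Φ`, and étale morphisms
have discrete fibers; hence `ω = Φᵃ(η)`. This point specializes to its image under `Φ^M`, and back
again after finitely many steps, so it is fixed by `Φ^M` (`iterate_eq_of_forall_return`). The orbit
thus has at most `a + M ≤ (a + b) N p^(1 + r)` members.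
-/

namespace PadicOrbit

/-! ### Endomorphisms that raise the order along an adic filtration -/

section Filtration

variable {R A : Type*} [CommRing R] [CommRing A] [Algebra R A]

/-- `IsShift m f s` says that the `R`-linear endomorphism `f` of `A` is congruent to the identity
to order `s` along the `m`-adic filtration: `f - 1` maps `m ^ i` into `m ^ (i + s)` for all `i`. -/
def IsShift (m : Ideal A) (f : Module.End R A) (s : ℕ) : Prop :=
  ∀ i : ℕ, ∀ a ∈ m ^ i, (f - 1) a ∈ m ^ (i + s)

variable {m : Ideal A}

theorem IsShift.sub_one_pow {f : Module.End R A} {s : ℕ} (hf : IsShift m f s) (j : ℕ) :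
    ∀ i : ℕ, ∀ a ∈ m ^ i, ((f - 1) ^ j) a ∈ m ^ (i + s * j) := by
  induction j with
  | zero => intro i a ha; simpa using ha
  | succ j ih =>
    intro i a ha
    have := ih _ _ (hf i a ha)
    rw [pow_succ, Module.End.mul_apply]
    convert this using 2
    ring

/-- An algebra endomorphism that is trivial on `m / m ^ 2` raises the `m`-adic order by one. -/
theorem isShift_one_of_algHom {ψ : A →ₐ[R] A} (hsurj : ∀ a : A, ∃ c : R, a - algebraMap R A c ∈ m)
    (hψ : ∀ a ∈ m, ψ a - a ∈ m ^ 2) : IsShift m ψ.toLinearMap 1 := by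
  have h0 : ∀ a : A, ψ a - a ∈ m ^ 2 := by
    intro a
    obtain ⟨c, hc⟩ := hsurj a
    have := hψ _ hc
    rw [map_sub, AlgHom.commutes] at this
    convert this using 1
    ring
  have hm : ∀ a ∈ m, ψ a ∈ m := by
    intro a ha
    have h1 := Ideal.pow_le_self two_ne_zero (hψ a ha)
    simpa using m.add_mem h1 ha
  intro i
  induction i with
  | zero =>
    intro a _
    exact Ideal.pow_le_pow_right (by norm_num) (h0 a)
  | succ i ih =>
    intro a ha
    rw [pow_succ] at ha
    refine Submodule.mul_induction_on ha ?_ ?_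
    · intro x hx y hy
      have h1 : (ψ.toLinearMap - 1) (x * y)
          = (ψ x - x) * ψ y + x * (ψ y - y) := by
        simp only [LinearMap.sub_apply, AlgHom.toLinearMap_apply, map_mul, Module.End.one_apply]
        ring
      rw [h1]
      refine Ideal.add_mem _ ?_ ?_
      · rw [pow_succ]
        refine Ideal.mul_mem_mul ?_ (hm y hy)
        simpa using ih x hx
      · have := Ideal.mul_mem_mul hx (hψ y hy)
        rwa [← pow_add] at this
    · intro x y hx hy
      rw [map_add]
      exact Ideal.add_mem _ hx hy

/-- Binomial expansion of the `p`-th power of an endomorphism, grouped according to divisibility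
of the coefficients by `p`. -/
theorem pow_prime_sub_one_apply {p : ℕ} (hp : p.Prime) (f : Module.End R A) (a : A) :
    (f ^ p - 1) a = (∑ j ∈ Finset.Ico 1 p, (p : A) * ((p.choose j / p : ℕ) * ((f - 1) ^ j) a))
      + ((f - 1) ^ p) a := by
  have h1 : f ^ p = ∑ j ∈ Finset.range (p + 1), (p.choose j) • (f - 1) ^ j := by
    have := (Commute.one_right (f - 1)).add_pow p
    simpa [nsmul_eq_mul, Nat.cast_comm] using this
  have h2 : ∀ j ∈ Finset.Ico 1 p, (p.choose j : A) = p * (p.choose j / p : ℕ) := by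
    intro j hj
    rw [Finset.mem_Ico] at hj
    rw [← Nat.cast_mul, Nat.mul_div_cancel' (hp.dvd_choose_self (by omega) hj.2)]
  rw [h1, Finset.sum_range_succ, Finset.range_eq_Ico, Finset.sum_eq_sum_Ico_succ_bot hp.pos]
  simp only [Nat.choose_zero_right, pow_zero, one_smul, Nat.choose_self, zero_add]
  rw [add_assoc, add_sub_cancel_left, LinearMap.add_apply, LinearMap.sum_apply]
  congr 1
  refine Finset.sum_congr rfl fun j hj => ?_
  rw [LinearMap.smul_apply, nsmul_eq_mul, h2 j hj, mul_assoc]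

/-- If `f` raises the order by `s` and `p` lies in `m ^ e`, then `f ^ p` raises it by `s'` for any
`s' ≤ min (e + s) (p * s)`. -/
theorem IsShift.pow_prime {p : ℕ} (hp : p.Prime) {e s s' : ℕ} (hpe : (p : A) ∈ m ^ e)
    {f : Module.End R A} (hf : IsShift m f s) (h1 : s' ≤ e + s) (h2 : s' ≤ p * s) :
    IsShift m (f ^ p) s' := by
  intro i a ha
  rw [pow_prime_sub_one_apply hp]
  refine Ideal.add_mem _ (Ideal.sum_mem _ fun j hj => ?_) ?_
  · rw [Finset.mem_Ico] at hj
    have h3 := Ideal.mul_mem_left _ ((p.choose j / p : ℕ) : A) (hf.sub_one_pow j i a ha)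
    have h4 := Ideal.mul_mem_mul hpe h3
    rw [← pow_add] at h4
    refine Ideal.pow_le_pow_right ?_ h4
    have : s * 1 ≤ s * j := Nat.mul_le_mul_left _ hj.1
    omega
  · refine Ideal.pow_le_pow_right ?_ (hf.sub_one_pow p i a ha)
    rw [mul_comm s p]
    omega

/-- Iterating `p`-th powers doubles the order until it exceeds `e / (p - 1)`. -/
theorem IsShift.exists_pow_prime_pow {p : ℕ} (hp : p.Prime) {e : ℕ} (hpe : (p : A) ∈ m ^ e)
    {f : Module.End R A} (hf : IsShift m f 1) {r : ℕ} (hr : e < 2 ^ r * (p - 1)) :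
    ∃ s, IsShift m (f ^ p ^ r) s ∧ e < s * (p - 1) := by
  have hp2 := hp.two_le
  have key : ∀ n : ℕ, ∃ s, IsShift m (f ^ p ^ n) s ∧ (2 ^ n ≤ s ∨ e < s * (p - 1)) := by
    intro n
    induction n with
    | zero => exact ⟨1, by simpa using hf, by simp⟩
    | succ n ih =>
      obtain ⟨s, hs, h⟩ := ih
      rw [pow_succ, pow_mul]
      by_cases hes : e < s * (p - 1)
      · exact ⟨s, hs.pow_prime hp hpe (by omega) (by nlinarith), Or.inr hes⟩
      · refine ⟨2 * s, hs.pow_prime hp hpe ?_ (by nlinarith), Or.inl ?_⟩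
        · have : s * 1 ≤ s * (p - 1) := Nat.mul_le_mul_left _ (by omega)
          omega
        · rw [pow_succ]
          omega
  obtain ⟨s, hs, h⟩ := key r
  refine ⟨s, hs, ?_⟩
  rcases h with h | h
  · exact hr.trans_le (Nat.mul_le_mul_right _ h)
  · exact h

/-- An endomorphism that is trivial on `m / (m ^ 2 + (π))` is unipotent on `m / m ^ 2`, so its
`p`-th power is trivial there. -/
theorem pow_prime_sub_mem_sq {p : ℕ} (hp : p.Prime) (hpm : (p : A) ∈ m) {ϖ : R}
    (hϖ : algebraMap R A ϖ ∈ m) (hsurj : ∀ a : A, ∃ c : R, a - algebraMap R A c ∈ m)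
    {ψ : A →ₐ[R] A} (hψ : ∀ a ∈ m, ψ a - a ∈ m ^ 2 ⊔ Ideal.span {algebraMap R A ϖ}) :
    ∀ a ∈ m, (ψ.toLinearMap ^ p) a - a ∈ m ^ 2 := by
  have hsq : m ^ 2 ≤ m := Ideal.pow_le_self two_ne_zero
  have hle : m ^ 2 ⊔ Ideal.span {algebraMap R A ϖ} ≤ m :=
    sup_le hsq ((Ideal.span_singleton_le_iff_mem _).2 hϖ)
  set D : Module.End R A := ψ.toLinearMap - 1 with hD
  have hDapp : ∀ a, D a = ψ a - a := fun a => by simp [hD]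
  have hDm : ∀ a ∈ m, D a ∈ m := fun a ha => by rw [hDapp]; exact hle (hψ a ha)
  have hψm : ∀ a ∈ m, ψ a ∈ m := by
    intro a ha
    simpa using m.add_mem (hle (hψ a ha)) ha
  have hDsq : ∀ a ∈ m ^ 2, D a ∈ m ^ 2 := by
    intro a ha
    rw [hDapp]
    refine Ideal.sub_mem _ ?_ ha
    have h1 := Ideal.mem_map_of_mem ψ.toRingHom ha
    rw [Ideal.map_pow] at h1
    refine Ideal.pow_right_mono (Ideal.map_le_iff_le_comap.2 fun x hx => ?_) 2 h1
    exact hψm x hx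
  have hDD : ∀ a ∈ m, D (D a) ∈ m ^ 2 := by
    intro a ha
    have h1 := hψ a ha
    rw [← hDapp] at h1
    obtain ⟨u, hu, v, hv, huv⟩ := Submodule.mem_sup.1 h1
    obtain ⟨w, rfl⟩ := Ideal.mem_span_singleton.1 hv
    obtain ⟨c, hc⟩ := hsurj w
    have h2 : D a = (u + algebraMap R A ϖ * (w - algebraMap R A c)) + algebraMap R A (ϖ * c) := by
      rw [← huv, map_mul]; ring
    have h3 : D (algebraMap R A (ϖ * c)) = 0 := by rw [hDapp, AlgHom.commutes, sub_self]
    rw [h2, map_add, h3, add_zero]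
    refine hDsq _ (Ideal.add_mem _ hu ?_)
    rw [pow_two]
    exact Ideal.mul_mem_mul hϖ hc
  have hDj : ∀ a ∈ m, ∀ j, (D ^ (j + 2)) a ∈ m ^ 2 := by
    intro a ha j
    induction j with
    | zero => simpa [pow_two] using hDD a ha
    | succ j ih =>
      have h1 : D ^ (j + 1 + 2) = D * D ^ (j + 2) := pow_succ' D (j + 2)
      rw [h1, Module.End.mul_apply]
      exact hDsq _ ih
  intro a ha
  have h1 := pow_prime_sub_one_apply hp ψ.toLinearMap a
  rw [LinearMap.sub_apply, Module.End.one_apply] at h1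
  rw [h1]
  refine Ideal.add_mem _ (Ideal.sum_mem _ fun j hj => ?_) ?_
  · rw [pow_two]
    refine Ideal.mul_mem_mul hpm (Ideal.mul_mem_left _ _ ?_)
    rcases j with _ | _ | j
    · simpa using ha
    · rw [zero_add, pow_one]
      exact hDm a ha
    · exact hsq (hDj a ha j)
  · obtain ⟨q, hq⟩ := Nat.exists_eq_add_of_le hp.two_le
    rw [hq, add_comm]
    exact hDj a ha q

end Filtration

/-! ### Strassmann's theorem -/

section Strassmann

open Filter Topology

theorem norm_tsum_le_of_forall_le {K ι : Type*} [NormedField K] [IsUltrametricDist K] {f : ι → K}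
    {C : ℝ} (hC : 0 ≤ C) (h : ∀ i, ‖f i‖ ≤ C) : ‖∑' i, f i‖ ≤ C := by
  by_cases hf : Summable f
  · refine le_of_tendsto (hf.hasSum.norm) (Eventually.of_forall fun s => ?_)
    exact IsUltrametricDist.norm_sum_le_of_forall_le_of_nonneg hC fun i _ => h i
  · simpa [tsum_eq_zero_of_not_summable hf] using hC

/-- A null sequence all of whose terms have norm below `ε` is bounded away from `ε`. -/
theorem exists_lt_forall_norm_le {K : Type*} [NormedField K] {a : ℕ → K}
    (ha : Tendsto a atTop (𝓝 0)) {ε : ℝ} (hε : 0 < ε)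
    (h : ∀ n, ‖a n‖ < ε) : ∃ ρ, 0 ≤ ρ ∧ ρ < ε ∧ ∀ n, ‖a n‖ ≤ ρ := by
  obtain ⟨N, hN⟩ := Metric.tendsto_atTop.1 ha (ε / 2) (by positivity)
  have hne : (Finset.range (N + 1)).Nonempty := ⟨0, by simp⟩
  refine ⟨max (ε / 2) ((Finset.range (N + 1)).sup' hne fun n => ‖a n‖), ?_, ?_, ?_⟩
  · exact le_max_of_le_left (by positivity)
  · refine max_lt (by linarith) ((Finset.sup'_lt_iff _).2 fun n _ => h n)
  · intro n
    by_cases hn : n < N + 1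
    · exact le_max_of_le_right (Finset.le_sup' (fun n => ‖a n‖) (Finset.mem_range.2 hn))
    · refine le_max_of_le_left ?_
      simpa using (hN n (by omega)).le

variable {K : Type*} [NormedField K] [IsUltrametricDist K] [CompleteSpace K]

theorem summable_mul_pow {b : ℕ → K} (hb : Tendsto b atTop (𝓝 0)) {z : K} (hz : ‖z‖ ≤ 1) :
    Summable fun m => b m * z ^ m := by
  refine NonarchimedeanAddGroup.summable_of_tendsto_cofinite_zero ?_
  rw [Nat.cofinite_eq_atTop]
  refine squeeze_zero_norm (fun m => ?_) (tendsto_zero_iff_norm_tendsto_zero.1 hb)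
  rw [norm_mul, norm_pow]
  exact mul_le_of_le_one_right (norm_nonneg _) (pow_le_one₀ (norm_nonneg _) hz)

/-- The inductive form of Strassmann's theorem: if the coefficient of index `M` strictly dominates
all later ones, then the power series has finitely many zeros in the closed unit ball. The
induction on `M` divides by a linear factor `z - z₀`. -/
theorem finite_zeros_of_dominant (M : ℕ) : ∀ {b : ℕ → K}, Tendsto b atTop (𝓝 0) → b M ≠ 0 →
    (∀ m, M < m → ‖b m‖ < ‖b M‖) → {z : K | ‖z‖ ≤ 1 ∧ ∑' m, b m * z ^ m = 0}.Finite := by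
  induction M with
  | zero =>
    intro b hb h0 hlt
    convert Set.finite_empty
    rw [Set.eq_empty_iff_forall_notMem]
    rintro z ⟨hz, hsum⟩
    have hs := summable_mul_pow hb hz
    rw [hs.tsum_eq_zero_add] at hsum
    obtain ⟨ρ, hρ0, hρ, hle⟩ := exists_lt_forall_norm_le (a := fun m => b (m + 1))
      (hb.comp (tendsto_add_atTop_nat 1)) (norm_pos_iff.2 h0) (fun n => hlt _ (Nat.succ_pos n))
    have h1 : ‖∑' m, b (m + 1) * z ^ (m + 1)‖ ≤ ρ := by
      refine norm_tsum_le_of_forall_le hρ0 fun m => ?_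
      rw [norm_mul, norm_pow]
      exact (mul_le_of_le_one_right (norm_nonneg _) (pow_le_one₀ (norm_nonneg _) hz)).trans (hle m)
    rw [pow_zero, mul_one, add_eq_zero_iff_eq_neg] at hsum
    rw [hsum, norm_neg] at hρ
    exact absurd hρ (not_lt.2 h1)
  | succ M ih =>
    intro b hb h0 hlt
    rcases Set.eq_empty_or_nonempty {z : K | ‖z‖ ≤ 1 ∧ ∑' m, b m * z ^ m = 0} with
      he | ⟨z₀, hz₀, hs₀⟩
    · rw [he]; exact Set.finite_empty
    -- the coefficients of the quotient of the power series by `z - z₀`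
    let c : ℕ → K := fun k => ∑' j, b (k + 1 + j) * z₀ ^ j
    have hsc : ∀ k, Summable fun j => b (k + j) * z₀ ^ j := fun k =>
      summable_mul_pow (b := fun j => b (k + j)) (by
        simpa only [Function.comp_def, add_comm] using hb.comp (tendsto_add_atTop_nat k)) hz₀
    have hrec : ∀ k, ∑' j, b (k + j) * z₀ ^ j = b k + z₀ * c k := by
      intro k
      rw [(hsc k).tsum_eq_zero_add, ← tsum_mul_left]
      simp only [add_zero, pow_zero, mul_one]
      congr 1
      refine tsum_congr fun j => ?_
      rw [show k + (j + 1) = k + 1 + j by ring]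
      ring
    have hb0 : b 0 = - (z₀ * c 0) := by
      have := hrec 0
      simp only [zero_add] at this
      rw [hs₀] at this
      exact (neg_eq_of_add_eq_zero_left this.symm).symm
    have hbs : ∀ k, b (k + 1) = c k - z₀ * c (k + 1) := by
      intro k
      have := hrec (k + 1)
      exact (sub_eq_of_eq_add this).symm
    have hcle : ∀ k C, 0 ≤ C → (∀ j, ‖b (k + 1 + j)‖ ≤ C) → ‖c k‖ ≤ C := by
      intro k C hC h
      refine norm_tsum_le_of_forall_le hC fun j => ?_
      rw [norm_mul, norm_pow]
      exact (mul_le_of_le_one_right (norm_nonneg _) (pow_le_one₀ (norm_nonneg _) hz₀)).trans (h j)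
    have hc : Tendsto c atTop (𝓝 0) := by
      rw [Metric.tendsto_atTop]
      intro ε hε
      obtain ⟨N, hN⟩ := Metric.tendsto_atTop.1 hb (ε / 2) (by positivity)
      refine ⟨N, fun k hk => ?_⟩
      rw [dist_zero_right]
      refine (hcle k (ε / 2) (by positivity) fun j => ?_).trans_lt (by linarith)
      simpa using (hN (k + 1 + j) (by omega)).le
    obtain ⟨ρ, hρ0, hρ, hle⟩ := exists_lt_forall_norm_le (a := fun m => b (M + 2 + m))
      (by simpa [Function.comp_def, add_comm] using hb.comp (tendsto_add_atTop_nat (M + 2)))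
      (norm_pos_iff.2 h0) (fun n => hlt _ (by omega))
    have hclarge : ∀ k, M < k → ‖c k‖ ≤ ρ := fun k hk => hcle k ρ hρ0 fun j => by
      have := hle (k + 1 + j - (M + 2))
      rwa [show M + 2 + (k + 1 + j - (M + 2)) = k + 1 + j by omega] at this
    -- dividing by `z - z₀` moves the dominant coefficient down by one index
    have hcM : ‖c M‖ = ‖b (M + 1)‖ := by
      have h1 : c M = z₀ * c (M + 1) + b (M + 1) := by rw [hbs M]; ring
      have h2 : ‖z₀ * c (M + 1)‖ < ‖b (M + 1)‖ := by
        rw [norm_mul]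
        exact (mul_le_of_le_one_left (norm_nonneg _) hz₀).trans_lt
          ((hclarge _ (Nat.lt_succ_self M)).trans_lt hρ)
      rw [h1, IsUltrametricDist.norm_add_eq_max_of_norm_ne_norm h2.ne, max_eq_right h2.le]
    have hfin := ih hc (norm_pos_iff.1 (hcM ▸ norm_pos_iff.2 h0))
      (fun m hm => by rw [hcM]; exact (hclarge m hm).trans_lt hρ)
    refine (hfin.union (Set.finite_singleton z₀)).subset ?_
    rintro z ⟨hz, hs⟩
    by_cases hzz : z = z₀
    · exact Or.inr hzz
    refine Or.inl ⟨hz, ?_⟩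
    have hcz := summable_mul_pow hc hz
    have h1 : ∑' m, b m * z ^ m = (z - z₀) * ∑' m, c m * z ^ m := by
      rw [(summable_mul_pow hb hz).tsum_eq_zero_add]
      have h2 : ∀ k, b (k + 1) * z ^ (k + 1) =
          z * (c k * z ^ k) - z₀ * (c (k + 1) * z ^ (k + 1)) := by
        intro k; rw [hbs k]; ring
      rw [tsum_congr h2, ((hcz.mul_left z).tsum_sub
        (((summable_nat_add_iff 1).2 hcz).mul_left z₀)), tsum_mul_left, tsum_mul_left, hb0, sub_mul]
      nth_rewrite 3 [hcz.tsum_eq_zero_add]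
      ring
    rw [h1] at hs
    exact (mul_eq_zero.1 hs).resolve_left (sub_ne_zero.2 hzz)

/-- **Strassmann's theorem**: a nonzero power series whose coefficients tend to zero has finitely
many zeros in the closed unit ball. -/
theorem finite_zeros_of_tendsto_zero {b : ℕ → K} (hb : Tendsto b atTop (𝓝 0)) {n : ℕ}
    (hn : b n ≠ 0) : {z : K | ‖z‖ ≤ 1 ∧ ∑' m, b m * z ^ m = 0}.Finite := by
  -- `M` is the last index at which the norm of the coefficients is maximal
  obtain ⟨N, hN⟩ := Metric.tendsto_atTop.1 hb ‖b n‖ (norm_pos_iff.2 hn)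
  have hnN : n < N := by
    by_contra h
    have := hN n (not_lt.1 h)
    simp at this
  obtain ⟨M₀, hM₀, hmax⟩ := (Finset.range N).exists_max_image (fun m => ‖b m‖)
    ⟨n, Finset.mem_range.2 hnN⟩
  let S := (Finset.range N).filter fun m => ‖b M₀‖ ≤ ‖b m‖
  have hS : S.Nonempty := ⟨M₀, by simp [S, Finset.mem_range.1 hM₀]⟩
  have hMS := S.max'_mem hS
  set M := S.max' hS with hM
  obtain ⟨hMN, hMle⟩ := Finset.mem_filter.1 hMS
  have hnle : ‖b n‖ ≤ ‖b M₀‖ := hmax n (Finset.mem_range.2 hnN)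
  refine finite_zeros_of_dominant M hb ?_ ?_
  · exact norm_pos_iff.1 ((norm_pos_iff.2 hn).trans_le (hnle.trans hMle))
  · intro m hm
    by_cases hmN : m < N
    · refine lt_of_not_ge fun h => ?_
      have : m ∈ S := Finset.mem_filter.2 ⟨Finset.mem_range.2 hmN, hMle.trans h⟩
      exact absurd (S.le_max' m this) (not_le.2 hm)
    · have := hN m (not_lt.1 hmN)
      rw [dist_zero_right] at this
      exact this.trans_le (hnle.trans hMle)

/-- A Newton series `n ↦ ∑ d_j n (n - 1) ⋯ (n - j + 1)` with geometrically decaying coefficients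
extends to a power series convergent on the closed unit ball; so it vanishes identically as soon as
it has infinitely many zeros. -/
theorem sum_descFactorial_eq_zero_of_infinite [CharZero K] {d : ℕ → K} {θ : ℝ} (hθ0 : 0 ≤ θ)
    (hθ : θ < 1) (hd : ∀ j, ‖d j‖ ≤ θ ^ j)
    (hinf : {n : ℕ | ∑ j ∈ Finset.range (n + 1), d j * (n.descFactorial j : K) = 0}.Infinite)
    (n : ℕ) : ∑ j ∈ Finset.range (n + 1), d j * (n.descFactorial j : K) = 0 := by
  -- expand the falling factorials in powers of `n` and collect the powers
  let F : ℕ → ℕ → K := fun j m => d j * ((descPochhammer ℤ j).coeff m : K)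
  have hF0 : ∀ j m, j < m → F j m = 0 := by
    intro j m h
    simp only [F]
    rw [Polynomial.coeff_eq_zero_of_natDegree_lt (by rwa [descPochhammer_natDegree]), Int.cast_zero,
      mul_zero]
  have hF : ∀ j m, ‖F j m‖ ≤ θ ^ j := by
    intro j m
    rw [norm_mul]
    exact (mul_le_of_le_one_right (norm_nonneg _)
      (IsUltrametricDist.norm_intCast_le_one K _)).trans (hd j)
  have hF' : ∀ j m, ‖F j m‖ ≤ θ ^ m := by
    intro j m
    by_cases h : j < m
    · rw [hF0 j m h, norm_zero]; positivity
    · exact (hF j m).trans (pow_le_pow_of_le_one hθ0 hθ.le (not_lt.1 h))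
  have hpow := tendsto_pow_atTop_nhds_zero_of_lt_one hθ0 hθ
  let b : ℕ → K := fun m => ∑' j, F j m
  have hb : Tendsto b atTop (𝓝 0) :=
    squeeze_zero_norm (fun m => norm_tsum_le_of_forall_le (by positivity) fun j => hF' j m) hpow
  have hsum : ∀ n : ℕ, ∑ j ∈ Finset.range (n + 1), d j * (n.descFactorial j : K)
      = ∑' m, b m * (n : K) ^ m := by
    intro n
    have hn1 : ‖(n : K)‖ ≤ 1 := IsUltrametricDist.norm_natCast_le_one K n
    have hG : ∀ j m, ‖F j m * (n : K) ^ m‖ ≤ ‖F j m‖ := fun j m => by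
      rw [norm_mul, norm_pow]
      exact mul_le_of_le_one_right (norm_nonneg _) (pow_le_one₀ (norm_nonneg _) hn1)
    have hS : Summable (Function.uncurry fun j m => F j m * (n : K) ^ m) := by
      refine NonarchimedeanAddGroup.summable_of_tendsto_cofinite_zero ?_
      rw [Metric.tendsto_nhds]
      intro ε hε
      obtain ⟨N, hN⟩ := (hpow.eventually (gt_mem_nhds hε)).exists_forall_of_atTop
      refine ((Finset.range N ×ˢ Finset.range N).finite_toSet).subset ?_
      rintro ⟨j, m⟩ hjm
      simp only [Set.mem_compl_iff, Set.mem_ofPred_eq, dist_zero_right, Function.uncurry_apply_pair,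
        not_lt] at hjm
      have h1 := hjm.trans (hG j m)
      simp only [Finset.coe_product, Finset.coe_range, Set.mem_prod, Set.mem_Iio]
      constructor
      · by_contra h
        exact absurd (h1.trans (hF j m)) (not_le.2 (hN j (not_lt.1 h)))
      · by_contra h
        exact absurd (h1.trans (hF' j m)) (not_le.2 (hN m (not_lt.1 h)))
    have hrow : ∀ j, ∑' m, F j m * (n : K) ^ m = d j * (n.descFactorial j : K) := by
      intro j
      rw [tsum_eq_sum (s := Finset.range (j + 1)) fun m hm => by
        rw [hF0 j m (by simpa using hm), zero_mul]]
      rw [← descPochhammer_eval_eq_descFactorial, ← descPochhammer_map (Int.castRingHom K),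
        Polynomial.eval_eq_sum_range' (n := j + 1)
          ((Polynomial.natDegree_map_le).trans_lt (by rw [descPochhammer_natDegree]; omega)),
        Finset.mul_sum]
      refine Finset.sum_congr rfl fun m _ => ?_
      simp only [F, Polynomial.coeff_map, eq_intCast]
      ring
    have hfin : ∑' j, d j * (n.descFactorial j : K)
        = ∑ j ∈ Finset.range (n + 1), d j * (n.descFactorial j : K) :=
      tsum_eq_sum fun j hj => by
        rw [Nat.descFactorial_eq_zero_iff_lt.2 (by simpa using hj), Nat.cast_zero, mul_zero]
    rw [← hfin, ← tsum_congr hrow, ← hS.tsum_comm]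
    exact tsum_congr fun m => by simp only [b]; rw [tsum_mul_right]
  by_cases hz : ∀ m, b m = 0
  · simp [hsum, hz]
  · push Not at hz
    obtain ⟨m, hm⟩ := hz
    refine absurd hinf (Set.not_infinite.2 ?_)
    refine Set.Finite.of_finite_image ((finite_zeros_of_tendsto_zero hb hm).subset ?_)
      (f := fun n : ℕ => (n : K)) (Nat.cast_injective.injOn)
    rintro _ ⟨n, hn, rfl⟩
    exact ⟨IsUltrametricDist.norm_natCast_le_one K n, by rw [← hsum]; exact hn⟩

end Strassmann

/-! ### Interpolation of orbits and the order of an endomorphism on the cotangent space -/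

section Interpolation

variable {K : Type*} [NormedField K] [IsUltrametricDist K]

theorem norm_natCast_eq_pow_padicValNat {p : ℕ} [hp : Fact p.Prime] (hpK : ‖(p : K)‖ < 1) {n : ℕ}
    (hn : n ≠ 0) : ‖(n : K)‖ = ‖(p : K)‖ ^ padicValNat p n := by
  obtain ⟨q, hq⟩ := pow_padicValNat_dvd (p := p) (n := n)
  have hcop : ¬ p ∣ q := by
    rintro ⟨t, ht⟩
    apply pow_succ_padicValNat_not_dvd (p := p) hn
    exact ⟨t, by rw [pow_succ, mul_assoc, ← ht, ← hq]⟩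
  have hq1 : ‖(q : K)‖ = 1 := by
    refine le_antisymm (IsUltrametricDist.norm_natCast_le_one K q) (not_lt.1 fun hlt => ?_)
    have h1 := Int.gcd_eq_gcd_ab (p : ℤ) (q : ℤ)
    have h2 : Int.gcd (p : ℤ) (q : ℤ) = 1 := by
      rw [Int.gcd_natCast_natCast]
      exact (Nat.Prime.coprime_iff_not_dvd hp.out).2 hcop
    rw [h2] at h1
    have h3 : (1 : K) = p * (Int.gcdA p q : K) + q * (Int.gcdB p q : K) := by
      exact_mod_cast congrArg (Int.cast : ℤ → K) h1
    have h4 : ∀ (x : K) (z : ℤ), ‖x‖ < 1 → ‖x * z‖ < 1 := fun x z hx => by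
      rw [norm_mul]
      exact (mul_le_of_le_one_right (norm_nonneg _)
        (IsUltrametricDist.norm_intCast_le_one K z)).trans_lt hx
    have h5 := IsUltrametricDist.norm_add_le_max (p * (Int.gcdA p q : K)) (q * (Int.gcdB p q : K))
    rw [← h3, norm_one] at h5
    exact absurd h5 (not_le.2 (max_lt (h4 _ _ hpK) (h4 _ _ hlt)))
  conv_lhs => rw [hq]
  rw [Nat.cast_mul, norm_mul, hq1, mul_one, Nat.cast_pow, norm_pow]

/-- The `p`-adic valuation of `j!` is at most `j / (p - 1)`. -/
theorem pow_le_norm_factorial_pow {p : ℕ} [hp : Fact p.Prime] (hpK : ‖(p : K)‖ < 1) (j : ℕ) :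
    ‖(p : K)‖ ^ j ≤ ‖(j.factorial : K)‖ ^ (p - 1) := by
  rw [norm_natCast_eq_pow_padicValNat hpK j.factorial_ne_zero, ← pow_mul, mul_comm,
    sub_one_mul_padicValNat_factorial]
  exact pow_le_pow_of_le_one (norm_nonneg _) hpK.le (Nat.sub_le _ _)

variable [CompleteSpace K] [CharZero K]
variable {R A : Type*} [CommRing R] [CommRing A] [Algebra R A] [Algebra R K]

/-- The interpolation principle. If `f` raises the `m`-adic order by `s`, where `s` exceeds the
bound `e / (p - 1)` that governs the growth of `1 / j!`, then `n ↦ ζ (f ^ n a)` is given by a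
convergent Newton series, hence vanishes identically once it has infinitely many zeros. -/
theorem IsShift.eval_pow_eq_zero_of_infinite {p : ℕ} [hp : Fact p.Prime] (hpK : ‖(p : K)‖ < 1)
    {m : Ideal A} {f : Module.End R A} {s e : ℕ} (hf : IsShift m f s) (hs : e < s * (p - 1))
    (hinj : Function.Injective (algebraMap R K)) (hle : ∀ c : R, ‖algebraMap R K c‖ ≤ 1)
    {ϖ : R} (hϖ : ‖algebraMap R K ϖ‖ < 1) (hϖe : ‖algebraMap R K ϖ‖ ^ e ≤ ‖(p : K)‖)
    (ζ : A →ₐ[R] R) (hζ : ∀ a ∈ m, ζ a ∈ Ideal.span {ϖ}) (a : A)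
    (hinf : {n : ℕ | ζ ((f ^ n) a) = 0}.Infinite) (n : ℕ) : ζ ((f ^ n) a) = 0 := by
  have hp1 : 0 < p - 1 := Nat.sub_pos_of_lt hp.out.one_lt
  set q := ‖algebraMap R K ϖ‖ with hq
  have hq0 : 0 ≤ q := norm_nonneg _
  have hζpow : ∀ i, ∀ a ∈ m ^ i, ‖algebraMap R K (ζ a)‖ ≤ q ^ i := by
    intro i a ha
    have h1 := Ideal.mem_map_of_mem ζ.toRingHom ha
    rw [Ideal.map_pow] at h1
    have hmap : m.map ζ.toRingHom ≤ Ideal.span {ϖ} :=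
      Ideal.map_le_iff_le_comap.2 fun x hx => hζ x hx
    have h2 := Ideal.pow_right_mono hmap i h1
    rw [Ideal.span_singleton_pow, Ideal.mem_span_singleton] at h2
    obtain ⟨c, hc⟩ := h2
    change ζ a = _ at hc
    rw [hc, map_mul, map_pow, norm_mul, norm_pow]
    exact mul_le_of_le_one_right (by positivity) (hle c)
  -- the coefficients of the Newton series decay like `q ^ (j / (p - 1))`
  let θ : ℝ := q ^ (((p - 1 : ℕ) : ℝ)⁻¹)
  have hθ0 : 0 ≤ θ := by positivity
  have hθp : θ ^ (p - 1) = q := Real.rpow_inv_natCast_pow hq0 hp1.ne'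
  have hθ1 : θ < 1 := by
    by_contra h
    exact absurd (hθp ▸ one_le_pow₀ (not_lt.1 h)) (not_le.2 hϖ)
  let d : ℕ → K := fun j => algebraMap R K (ζ (((f - 1) ^ j) a)) / (j.factorial : K)
  have hfac : ∀ j : ℕ, (j.factorial : K) ≠ 0 := fun j => Nat.cast_ne_zero.2 j.factorial_ne_zero
  have hd : ∀ j, ‖d j‖ ≤ θ ^ j := by
    intro j
    have h1 : ‖algebraMap R K (ζ (((f - 1) ^ j) a))‖ ≤ q ^ (s * j) :=
      hζpow _ _ (by simpa using hf.sub_one_pow j 0 a (by simp))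
    refine le_of_pow_le_pow_left₀ hp1.ne' (by positivity) ?_
    rw [← pow_mul, mul_comm j, pow_mul, hθp, norm_div, div_pow,
      div_le_iff₀ (pow_pos (norm_pos_iff.2 (hfac j)) _)]
    calc ‖algebraMap R K (ζ (((f - 1) ^ j) a))‖ ^ (p - 1)
        ≤ (q ^ (s * j)) ^ (p - 1) := pow_le_pow_left₀ (norm_nonneg _) h1 _
      _ = q ^ (s * (p - 1) * j) := by rw [← pow_mul]; congr 1; ring
      _ ≤ q ^ ((e + 1) * j) := pow_le_pow_of_le_one hq0 hϖ.le (Nat.mul_le_mul_right _ hs)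
      _ = q ^ j * (q ^ e) ^ j := by rw [← pow_mul, ← pow_add]; congr 1; ring
      _ ≤ q ^ j * ‖(j.factorial : K)‖ ^ (p - 1) := by
        refine mul_le_mul_of_nonneg_left ?_ (by positivity)
        exact (pow_le_pow_left₀ (by positivity) hϖe j).trans (pow_le_norm_factorial_pow hpK j)
  have hexp : ∀ n, algebraMap R K (ζ ((f ^ n) a))
      = ∑ j ∈ Finset.range (n + 1), d j * (n.descFactorial j : K) := by
    intro n
    have h1 : f ^ n = ∑ j ∈ Finset.range (n + 1), (n.choose j) • (f - 1) ^ j := by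
      have := (Commute.one_right (f - 1)).add_pow n
      simpa [nsmul_eq_mul, Nat.cast_comm] using this
    rw [h1, LinearMap.sum_apply, map_sum, map_sum]
    refine Finset.sum_congr rfl fun j _ => ?_
    rw [LinearMap.smul_apply, map_nsmul, map_nsmul, nsmul_eq_mul,
      Nat.descFactorial_eq_factorial_mul_choose, Nat.cast_mul, ← mul_assoc,
      div_mul_cancel₀ _ (hfac j), mul_comm]
  have hz : ∀ n, ζ ((f ^ n) a) = 0 ↔
      ∑ j ∈ Finset.range (n + 1), d j * (n.descFactorial j : K) = 0 := by
    intro n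
    rw [← hexp, map_eq_zero_iff _ hinj]
  simp only [hz] at hinf ⊢
  exact sum_descFactorial_eq_zero_of_infinite hθ0 hθ1 hd hinf n

end Interpolation

section FiniteOrder

/-- A surjective endomorphism of a vector space of dimension at most `g` over a finite field `k`
has order at most `#GL_g(k)`. -/
theorem exists_pow_eq_one_of_surjective {k V : Type*} [Field k] [Finite k] [AddCommGroup V]
    [Module k V] [Module.Finite k V] {g : ℕ} (hg : Module.finrank k V ≤ g) {T : V →ₗ[k] V}
    (hT : Function.Surjective T) :
    ∃ N, 0 < N ∧ N ≤ Nat.card (GL (Fin g) k) ∧ T ^ N = 1 := by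
  -- extend `T` by the identity of a complement to an automorphism of `k ^ g`
  let W := Fin (g - Module.finrank k V) → k
  let E : (V × W) ≃ₗ[k] (Fin g → k) := LinearEquiv.ofFinrankEq _ _ (by
    rw [Module.finrank_prod, Module.finrank_fin_fun, Module.finrank_fin_fun]; omega)
  let S : Module.End k (V × W) := T.prodMap LinearMap.id
  have hS : Function.Surjective S := Function.Surjective.prodMap hT Function.surjective_id
  have hinj := LinearMap.injective_iff_surjective.2 hS
  let S' : (V × W) ≃ₗ[k] (V × W) := LinearEquiv.ofBijective S ⟨hinj, hS⟩
  let S'' : (Fin g → k) ≃ₗ[k] (Fin g → k) := (E.symm.trans S').trans E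
  let G : GL (Fin g) k := Matrix.GeneralLinearGroup.toLin.symm
    ((LinearMap.GeneralLinearGroup.generalLinearEquiv k _).symm S'')
  have hGN : G ^ orderOf G = 1 := pow_orderOf_eq_one G
  refine ⟨orderOf G, orderOf_pos G, orderOf_le_card, ?_⟩
  have h1 : S'' ^ orderOf G = 1 := by
    have h2 := congrArg (fun x => LinearMap.GeneralLinearGroup.generalLinearEquiv k _
      (Matrix.GeneralLinearGroup.toLin x)) hGN
    simpa only [map_pow, map_one, G, MulEquiv.apply_symm_apply] using h2
  have h3 : ∀ (n : ℕ) (v : V), (S'' ^ n) (E (v, 0)) = E ((T ^ n) v, 0) := by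
    intro n v
    induction n with
    | zero => simp
    | succ n ih =>
      rw [pow_succ', LinearEquiv.mul_apply, ih, pow_succ', Module.End.mul_apply]
      simp only [S'', LinearEquiv.trans_apply, LinearEquiv.symm_apply_apply]
      rfl
  ext v
  have h4 := h3 (orderOf G) v
  rw [h1, LinearEquiv.coe_one, id] at h4
  simpa using (congrArg Prod.fst (E.injective h4)).symm

variable {R A : Type*} [CommRing R] [IsLocalRing R] [CommRing A] [Algebra R A]

/-- The action on the relative cotangent space: if `ψ` is unramified, then a power of `ψ` with
exponent at most `#GL_g(k)` is trivial on `m / (m ^ 2 + (π))`, a space of dimension at most `g`. -/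
theorem exists_pow_sub_mem [Finite (IsLocalRing.ResidueField R)] {m : Ideal A} {ϖ : R}
    (hmax : IsLocalRing.maximalIdeal R = Ideal.span {ϖ})
    (hsurj : ∀ a : A, ∃ c : R, a - algebraMap R A c ∈ m) {d g : ℕ} (hdg : d ≤ g) {x : Fin d → A}
    (hx : m = Ideal.span (insert (algebraMap R A ϖ) (Set.range x))) {ψ : A →ₐ[R] A}
    (hψ : m = m.map ψ) :
    ∃ N, 0 < N ∧ N ≤ Nat.card (GL (Fin g) (IsLocalRing.ResidueField R)) ∧
      ∀ a ∈ m, (ψ.toLinearMap ^ N) a - a ∈ m ^ 2 ⊔ Ideal.span {algebraMap R A ϖ} := by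
  set n : Ideal A := m ^ 2 ⊔ Ideal.span {algebraMap R A ϖ} with hn
  have hψm : ∀ a ∈ m, ψ a ∈ m := fun a ha => by
    rw [hψ]; exact Ideal.mem_map_of_mem ψ ha
  have hψn : ∀ a ∈ n, ψ a ∈ n := by
    intro a ha
    have h1 : n ≤ n.comap ψ := by
      refine sup_le ?_ ?_
      · rw [← Ideal.map_le_iff_le_comap, Ideal.map_pow, ← hψ]
        exact le_sup_left
      · rw [Ideal.span_singleton_le_iff_mem, Ideal.mem_comap, AlgHom.commutes]
        exact Ideal.mem_sup_right (Ideal.mem_span_singleton_self _)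
    exact h1 ha
  let M : Submodule R A := m.restrictScalars R
  let N : Submodule R M := (n.restrictScalars R).comap M.subtype
  let V := M ⧸ N
  have htors : Module.IsTorsionBySet R V (IsLocalRing.maximalIdeal R : Set R) := by
    rintro v ⟨c, hc⟩
    obtain ⟨⟨a, ha⟩, rfl⟩ := Submodule.Quotient.mk_surjective N v
    rw [hmax] at hc
    obtain ⟨c', rfl⟩ := Ideal.mem_span_singleton.1 hc
    change (ϖ * c') • Submodule.Quotient.mk _ = _
    rw [← Submodule.Quotient.mk_smul, Submodule.Quotient.mk_eq_zero]
    change (ϖ * c') • a ∈ n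
    rw [Algebra.smul_def, map_mul, mul_assoc]
    exact Ideal.mem_sup_right (Ideal.mul_mem_right _ _ (Ideal.mem_span_singleton_self _))
  let : Module (IsLocalRing.ResidueField R) V := htors.module
  have hsmul : ∀ (c : R) (v : V), IsLocalRing.residue R c • v = c • v := fun c v => rfl
  let t : M →ₗ[R] M := ψ.toLinearMap.restrict fun a ha => hψm a ha
  let T₀ : V →ₗ[R] V := N.mapQ N t fun a ha => hψn _ ha
  let T : V →ₗ[IsLocalRing.ResidueField R] V :=
    { T₀ with
      map_smul' := by
        intro c v
        obtain ⟨c, rfl⟩ := IsLocalRing.residue_surjective c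
        exact T₀.map_smul c v }
  have hxm : ∀ i, x i ∈ m := fun i => by
    rw [hx]; exact Ideal.subset_span (Or.inr ⟨i, rfl⟩)
  let w : Fin d → V := fun i => Submodule.Quotient.mk ⟨x i, hxm i⟩
  -- an `A`-multiple of an element of `m` is an `R`-multiple of it modulo `m ^ 2`
  have hred : ∀ a : A, ∀ b ∈ m, ∃ c : R, a * b - c • b ∈ m ^ 2 := by
    intro a b hb
    obtain ⟨c, hc⟩ := hsurj a
    refine ⟨c, ?_⟩
    rw [Algebra.smul_def, ← sub_mul, pow_two]
    exact Ideal.mul_mem_mul hc hb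
  have hspan : ⊤ ≤ Submodule.span (IsLocalRing.ResidueField R) (Set.range w) := by
    rintro v -
    obtain ⟨⟨a, ha⟩, rfl⟩ := Submodule.Quotient.mk_surjective N v
    have ha' : a ∈ Ideal.span (insert (algebraMap R A ϖ) (Set.range x)) := hx ▸ ha
    have key : ∀ a ∈ Ideal.span (insert (algebraMap R A ϖ) (Set.range x)), ∀ ha : a ∈ m,
        (Submodule.Quotient.mk ⟨a, ha⟩ : V) ∈
          Submodule.span (IsLocalRing.ResidueField R) (Set.range w) := by
      intro a ha'
      refine Submodule.span_induction (p := fun a _ => ∀ ha : a ∈ m,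
        (Submodule.Quotient.mk ⟨a, ha⟩ : V) ∈
          Submodule.span (IsLocalRing.ResidueField R) (Set.range w)) ?_ ?_ ?_ ?_ ha'
      · rintro y (rfl | ⟨i, rfl⟩) hy
        · have : (Submodule.Quotient.mk ⟨_, hy⟩ : V) = 0 := by
            rw [Submodule.Quotient.mk_eq_zero]
            exact Ideal.mem_sup_right (Ideal.mem_span_singleton_self _)
          rw [this]
          exact Submodule.zero_mem _
        · exact Submodule.subset_span ⟨i, rfl⟩
      · intro h
        exact Submodule.zero_mem _
      · intro y z hy hz ihy ihz h
        exact Submodule.add_mem _ (ihy (hx ▸ hy)) (ihz (hx ▸ hz))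
      · intro r y hy ihy h
        have hym : y ∈ m := hx ▸ hy
        obtain ⟨c, hc⟩ := hred r y hym
        have : (Submodule.Quotient.mk ⟨r • y, h⟩ : V)
            = IsLocalRing.residue R c • Submodule.Quotient.mk ⟨y, hym⟩ := by
          rw [hsmul, ← Submodule.Quotient.mk_smul, Submodule.Quotient.eq]
          exact Ideal.mem_sup_left hc
        rw [this]
        exact Submodule.smul_mem _ _ (ihy hym)
    exact key a ha' ha
  have hfin : Module.Finite (IsLocalRing.ResidueField R) V :=
    ⟨Submodule.fg_def.2 ⟨Set.range w, Set.finite_range w, top_le_iff.1 hspan⟩⟩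
  have hrank : Module.finrank (IsLocalRing.ResidueField R) V ≤ g := by
    refine le_trans ?_ hdg
    have h1 := finrank_range_le_card (R := IsLocalRing.ResidueField R) w
    rw [Set.finrank, top_le_iff.1 hspan, finrank_top, Fintype.card_fin] at h1
    exact h1
  -- as `ψ` maps `m` to a generating set of `m`, it is surjective on the quotient
  have hTsurj : Function.Surjective T := by
    intro v
    obtain ⟨⟨a, ha⟩, rfl⟩ := Submodule.Quotient.mk_surjective N v
    have key : ∀ a ∈ m.map ψ, ∃ b ∈ m, a - ψ b ∈ m ^ 2 := by
      intro a ha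
      refine Submodule.span_induction (p := fun a _ => ∃ b ∈ m, a - ψ b ∈ m ^ 2) ?_ ?_ ?_ ?_ ha
      · rintro _ ⟨b, hb, rfl⟩
        exact ⟨b, hb, by simp⟩
      · exact ⟨0, m.zero_mem, by simp⟩
      · rintro y z - - ⟨b, hb, h1⟩ ⟨b', hb', h2⟩
        refine ⟨b + b', m.add_mem hb hb', ?_⟩
        convert Ideal.add_mem _ h1 h2 using 1
        rw [map_add]; ring
      · rintro r y hy ⟨b, hb, h1⟩
        obtain ⟨c, hc⟩ := hred r (ψ b) (hψm b hb)
        refine ⟨c • b, Submodule.smul_of_tower_mem _ _ hb, ?_⟩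
        convert Ideal.add_mem _ (Ideal.mul_mem_left _ r h1) hc using 1
        rw [map_smul, smul_eq_mul]; ring
    obtain ⟨b, hb, h⟩ := key a (hψ ▸ ha)
    refine ⟨Submodule.Quotient.mk ⟨b, hb⟩, ?_⟩
    refine (Submodule.Quotient.eq N).2 ?_
    change ψ b - a ∈ n
    rw [← neg_sub, Ideal.neg_mem_iff]
    exact Ideal.mem_sup_left h
  obtain ⟨N₁, hpos, hle, hT1⟩ := exists_pow_eq_one_of_surjective hrank hTsurj
  refine ⟨N₁, hpos, hle, fun a ha => ?_⟩
  have hiter : ∀ (j : ℕ) (a : A) (ha : a ∈ m), ∃ h : (ψ.toLinearMap ^ j) a ∈ m,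
      (T ^ j) (Submodule.Quotient.mk ⟨a, ha⟩) = Submodule.Quotient.mk ⟨_, h⟩ := by
    intro j a ha
    induction j with
    | zero => exact ⟨ha, rfl⟩
    | succ j ih =>
      obtain ⟨h, hj⟩ := ih
      have h1 : (ψ.toLinearMap ^ (j + 1)) a = ψ ((ψ.toLinearMap ^ j) a) := by
        rw [pow_succ', Module.End.mul_apply, AlgHom.toLinearMap_apply]
      simp only [h1]
      refine ⟨hψm _ h, ?_⟩
      rw [pow_succ', Module.End.mul_apply, hj]
      rfl
  obtain ⟨h, hj⟩ := hiter N₁ a ha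
  rw [hT1, Module.End.one_apply] at hj
  exact (Submodule.Quotient.eq N).1 hj.symm

end FiniteOrder

section Recurrence

theorem exists_algHom_toLinearMap_eq_pow {R A : Type*} [CommRing R] [CommRing A] [Algebra R A]
    (ψ : A →ₐ[R] A) (n : ℕ) : ∃ χ : A →ₐ[R] A, χ.toLinearMap = ψ.toLinearMap ^ n := by
  induction n with
  | zero => exact ⟨AlgHom.id R A, rfl⟩
  | succ n ih =>
    obtain ⟨χ, hχ⟩ := ih
    exact ⟨ψ.comp χ, by rw [pow_succ', ← hχ]; rfl⟩

variable {K : Type*} [NormedField K] [IsUltrametricDist K] [CompleteSpace K] [CharZero K]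
variable {R A : Type*} [CommRing R] [IsLocalRing R] [CommRing A] [Algebra R A] [Algebra R K]

/-- The local form of the recurrence principle: for an unramified local endomorphism `ψ` there is an
exponent `N ≤ #GL_g(k)` such that an `R`-point `ζ` whose images under infinitely many iterates of
`ψ ^ (N * p ^ (1 + r))` lie on a hypersurface has all these images on the hypersurface. -/
theorem exists_pow_eval_eq_zero {p : ℕ} [hp : Fact p.Prime] (hpK : ‖(p : K)‖ < 1)
    [Finite (IsLocalRing.ResidueField R)]
    (hinj : Function.Injective (algebraMap R K)) (hle : ∀ c : R, ‖algebraMap R K c‖ ≤ 1)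
    {ϖ : R} (hϖ : ‖algebraMap R K ϖ‖ < 1) {e r : ℕ} (he : e ≠ 0)
    (hϖe : ‖algebraMap R K ϖ‖ ^ e ≤ ‖(p : K)‖) (hpe : ϖ ^ e ∣ (p : R)) (hr : e < 2 ^ r * (p - 1))
    (hmax : IsLocalRing.maximalIdeal R = Ideal.span {ϖ}) {m : Ideal A}
    (hϖm : algebraMap R A ϖ ∈ m) (hsurj : ∀ a : A, ∃ c : R, a - algebraMap R A c ∈ m)
    {d g : ℕ} (hdg : d ≤ g) {x : Fin d → A}
    (hx : m = Ideal.span (insert (algebraMap R A ϖ) (Set.range x))) {ψ : A →ₐ[R] A}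
    (hψ : m = m.map ψ) :
    ∃ N, 0 < N ∧ N ≤ Nat.card (GL (Fin g) (IsLocalRing.ResidueField R)) ∧
      ∀ ζ : A →ₐ[R] R, (∀ a ∈ m, ζ a ∈ Ideal.span {ϖ}) → ∀ a : A,
        {n : ℕ | ζ (((ψ.toLinearMap ^ (N * p ^ (1 + r))) ^ n) a) = 0}.Infinite →
          ∀ n, ζ (((ψ.toLinearMap ^ (N * p ^ (1 + r))) ^ n) a) = 0 := by
  obtain ⟨N, hpos, hN, h1⟩ := exists_pow_sub_mem hmax hsurj hdg hx hψ
  have hpe' : (p : A) ∈ m ^ e := by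
    obtain ⟨c, hc⟩ := hpe
    rw [← map_natCast (algebraMap R A), hc, map_mul, map_pow]
    exact Ideal.mul_mem_right _ _ (Ideal.pow_mem_pow hϖm e)
  obtain ⟨χ, hχ⟩ := exists_algHom_toLinearMap_eq_pow ψ N
  have h2 := pow_prime_sub_mem_sq hp.out (Ideal.pow_le_self he hpe') hϖm hsurj (ψ := χ)
    (fun a ha => by
      have := h1 a ha
      rwa [← hχ] at this)
  obtain ⟨χ', hχ'⟩ := exists_algHom_toLinearMap_eq_pow χ p
  have h3 := isShift_one_of_algHom hsurj (ψ := χ') (fun a ha => by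
    have := h2 a ha
    rwa [← hχ'] at this)
  obtain ⟨s, hs, hes⟩ := h3.exists_pow_prime_pow hp.out hpe' hr
  have h4 : χ'.toLinearMap ^ p ^ r = ψ.toLinearMap ^ (N * p ^ (1 + r)) := by
    rw [hχ', hχ, ← pow_mul, ← pow_mul]
    congr 1
    ring
  rw [h4] at hs
  exact ⟨N, hpos, hN, fun ζ hζ a =>
    hs.eval_pow_eq_zero_of_infinite hpK hes hinj hle hϖ hϖe ζ hζ a⟩

end Recurrence

/-! ### Integral points near a smooth point -/

section Density

open Filter Topology

variable {n : ℕ}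

/-- An element of a standard étale algebra over a domain that is not a zero divisor divides a
nonzero element of the base. -/
theorem exists_ne_zero_dvd_of_standardEtale {R E : Type*} [CommRing R] [IsDomain R] [CommRing E]
    [Algebra R E] (P : StandardEtalePresentation R E) {h : E} (hh : h ∈ nonZeroDivisors E) :
    ∃ g : R, g ≠ 0 ∧ h ∣ algebraMap R E g := by
  obtain ⟨q, k, hq⟩ := P.exists_mul_aeval_x_g_pow_eq_aeval_x h
  have hu : IsUnit (Polynomial.aeval P.x P.P.g ^ k) := P.hasMap.2.pow k
  have hx : IsIntegral R P.x := ⟨P.P.f, P.P.monic_f, P.hasMap.1⟩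
  have hint : IsIntegral R (Polynomial.aeval P.x q) := by
    have : Polynomial.aeval P.x q ∈ Algebra.adjoin R {P.x} :=
      Polynomial.aeval_mem_adjoin_singleton R P.x
    exact adjoin_le_integralClosure hx this
  rw [← hq] at hint
  have hnz : h * Polynomial.aeval P.x P.P.g ^ k ∈ nonZeroDivisors E :=
    mul_mem hh hu.mem_nonZeroDivisors
  obtain ⟨Q, hQm, hQ⟩ := hint
  obtain ⟨Q', hQ', hnd⟩ := Polynomial.exists_eq_pow_rootMultiplicity_mul_and_not_dvd Q hQm.ne_zero 0
  rw [map_zero, sub_zero] at hQ' hnd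
  rw [hQ', Polynomial.eval₂_mul, Polynomial.eval₂_pow, Polynomial.eval₂_X] at hQ
  have hQ1 := (mul_right_mem_nonZeroDivisors_eq_zero_iff
    ((nonZeroDivisors E).pow_mem hnz _)).1 ((mul_comm _ _).trans hQ)
  refine ⟨Q'.coeff 0, fun h0 => hnd (Polynomial.X_dvd_iff.2 h0), ?_⟩
  have h1 := Polynomial.X_mul_divX_add Q'
  rw [← h1, Polynomial.eval₂_add, Polynomial.eval₂_mul, Polynomial.eval₂_X, Polynomial.eval₂_C]
    at hQ1
  rw [eq_neg_of_add_eq_zero_right hQ1, mul_assoc]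
  exact (dvd_neg).2 (Dvd.intro _ rfl)

/-- The value at `(a, x)` of a polynomial in one variable over a polynomial ring. -/
noncomputable abbrev eval₂At {K : Type*} [CommRing K] (q : Polynomial (MvPolynomial (Fin n) K))
    (w : (Fin n → K) × K) : K :=
  q.eval₂ (MvPolynomial.eval w.1) w.2

/-- The `K`-points of a standard étale scheme over affine space are the solutions `(a, x)` of
`f (a, x) = 0` and `g (a, x) ≠ 0`. -/
theorem exists_algHom_of_root {K E : Type*} [Field K] [CommRing E] [Algebra K E]
    [Algebra (MvPolynomial (Fin n) K) E] [IsScalarTower K (MvPolynomial (Fin n) K) E]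
    (P : StandardEtalePresentation (MvPolynomial (Fin n) K) E) {w : (Fin n → K) × K}
    (hf : eval₂At P.P.f w = 0) (hg : eval₂At P.P.g w ≠ 0) :
    ∃ φ : E →ₐ[K] K, (∀ q, φ (algebraMap _ E q) = MvPolynomial.eval w.1 q) ∧
      ∀ q, φ (Polynomial.aeval P.x q) = eval₂At q w := by
  let _ : Algebra (MvPolynomial (Fin n) K) K := (MvPolynomial.eval w.1).toAlgebra
  have hmap : P.P.HasMap w.2 := ⟨hf, isUnit_iff_ne_zero.2 hg⟩
  let φ₀ : E →ₐ[MvPolynomial (Fin n) K] K := (P.P.lift w.2 hmap).comp P.equivRing.toAlgHom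
  have h1 : ∀ q, φ₀ (algebraMap _ E q) = MvPolynomial.eval w.1 q := fun q => φ₀.commutes q
  refine ⟨{ φ₀.toRingHom with commutes' := fun c => ?_ }, h1, fun q => ?_⟩
  · change φ₀ (algebraMap K E c) = c
    rw [IsScalarTower.algebraMap_apply K (MvPolynomial (Fin n) K) E, h1]
    simp [MvPolynomial.algebraMap_eq]
  · change φ₀ (Polynomial.aeval P.x q) = _
    have hx : φ₀ P.x = w.2 := by
      change P.P.lift w.2 hmap (P.equivRing P.x) = _
      rw [StandardEtalePresentation.equivRing_x, StandardEtalePair.lift_X]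
    rw [← Polynomial.aeval_algHom_apply, hx]
    rfl

variable {K : Type*} [NontriviallyNormedField K]

theorem analyticAt_eval₂At (q : Polynomial (MvPolynomial (Fin n) K)) (w : (Fin n → K) × K) :
    AnalyticAt K (eval₂At q) w := by
  have h : (eval₂At q : (Fin n → K) × K → K)
      = fun w => ∑ i ∈ Finset.range (q.natDegree + 1),
          MvPolynomial.eval w.1 (q.coeff i) * w.2 ^ i := by
    funext w
    exact Polynomial.eval₂_eq_sum_range _ _
  rw [h]
  refine Finset.analyticAt_fun_sum _ fun i _ => AnalyticAt.mul ?_ (analyticAt_snd.pow i)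
  have h2 := AnalyticAt.aeval_mvPolynomial (𝕜 := K) (z := w) (f := fun w : (Fin n → K) × K => w.1)
    (fun i => ((ContinuousLinearMap.proj (R := K) (φ := fun _ : Fin n => K) i).comp
      (ContinuousLinearMap.fst K (Fin n → K) K)).analyticAt w) (q.coeff i)
  simpa only [MvPolynomial.aeval_eq_eval] using h2

variable [CompleteSpace K]

/-- The implicit function theorem for a simple root: near `w`, the equation `f (a, x) = 0` can be
solved in `x` for every `a`. -/
theorem eventually_exists_root {f : Polynomial (MvPolynomial (Fin n) K)} {w : (Fin n → K) × K}
    (hf : eval₂At f w = 0) (hf' : eval₂At f.derivative w ≠ 0) {W : Set ((Fin n → K) × K)}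
    (hW : W ∈ 𝓝 w) : ∀ᶠ a in 𝓝 w.1, ∃ x, (a, x) ∈ W ∧ eval₂At f (a, x) = 0 := by
  let F : (Fin n → K) × K → (Fin n → K) × K := fun v => (v.1, eval₂At f v)
  let L : (Fin n → K) × K →L[K] K := fderiv K (eval₂At f) w
  have hL : HasStrictFDerivAt (eval₂At f) L w := (analyticAt_eval₂At f w).hasStrictFDerivAt
  let F' : (Fin n → K) × K →L[K] (Fin n → K) × K := (ContinuousLinearMap.fst K _ _).prod L
  have hF : HasStrictFDerivAt F F' w := hasStrictFDerivAt_fst.prodMk hL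
  -- the partial derivative in the direction of `x` is the derivative of the polynomial `f`
  have hLx : L (0, 1) = eval₂At f.derivative w := by
    have h1 : HasFDerivAt (fun x : K => ((w.1, x) : (Fin n → K) × K))
        (ContinuousLinearMap.inr K (Fin n → K) K) w.2 := hasFDerivAt_prodMk_right w.1 w.2
    have h2 := (hL.hasFDerivAt.comp w.2 h1).hasDerivAt
    have h3 : HasDerivAt (fun x => (f.map (MvPolynomial.eval w.1)).eval x)
        ((f.map (MvPolynomial.eval w.1)).derivative.eval w.2) w.2 := Polynomial.hasDerivAt _ _
    have h4 : (eval₂At f ∘ fun x : K => ((w.1, x) : (Fin n → K) × K))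
        = fun x => (f.map (MvPolynomial.eval w.1)).eval x := by
      funext x
      simp [Polynomial.eval_map]
    rw [h4] at h2
    have h5 := h2.unique h3
    rw [Polynomial.derivative_map, Polynomial.eval_map] at h5
    simpa using h5
  have hinj : Function.Injective (F' : (Fin n → K) × K →ₗ[K] (Fin n → K) × K) := by
    rw [← LinearMap.ker_eq_bot, LinearMap.ker_eq_bot']
    rintro ⟨a, x⟩ hax
    have h1 : a = 0 := congrArg Prod.fst hax
    have h2 : L (a, x) = 0 := congrArg Prod.snd hax
    subst h1
    have h3 : ((0 : Fin n → K), x) = x • ((0 : Fin n → K), (1 : K)) := by simp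
    rw [h3, map_smul, hLx, smul_eq_mul] at h2
    rw [(mul_eq_zero.1 h2).resolve_right hf']
    rfl
  let e : ((Fin n → K) × K) ≃L[K] (Fin n → K) × K :=
    (LinearEquiv.ofInjectiveEndo _ hinj).toContinuousLinearEquiv
  have he : (e : (Fin n → K) × K →L[K] (Fin n → K) × K) = F' := by
    exact ContinuousLinearMap.ext fun v => rfl
  rw [← he] at hF
  have hmap := hF.map_nhds_eq_of_equiv
  have h1 : F '' W ∈ 𝓝 (F w) := hmap ▸ image_mem_map hW
  have hFw : F w = (w.1, 0) := by simp [F, hf]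
  rw [hFw] at h1
  have hcont : Tendsto (fun a : Fin n → K => (a, (0 : K))) (𝓝 w.1) (𝓝 (w.1, 0)) :=
    (Continuous.prodMk_left (0 : K)).tendsto w.1
  filter_upwards [hcont h1] with a ha
  obtain ⟨⟨a', x⟩, hv, hFv⟩ := ha
  obtain ⟨rfl, h3⟩ := Prod.mk.inj hFv
  exact ⟨x, hv, h3⟩

/-- `K`-points of a standard étale scheme over affine space that are close to a given one are
dense: they do not all lie on a hypersurface defined by a nonzerodivisor. -/
theorem exists_algHom_close {E : Type*} [CommRing E] [Algebra K E]
    [Algebra (MvPolynomial (Fin n) K) E] [IsScalarTower K (MvPolynomial (Fin n) K) E]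
    (P : StandardEtalePresentation (MvPolynomial (Fin n) K) E) (φ₀ : E →ₐ[K] K)
    {s : Set E} (hs : s.Finite) {h : E} (hh : h ∈ nonZeroDivisors E) :
    ∃ φ : E →ₐ[K] K, (∀ c ∈ s, ‖φ c - φ₀ c‖ < 1) ∧ φ h ≠ 0 := by
  let w : (Fin n → K) × K :=
    (fun i => φ₀ (algebraMap (MvPolynomial (Fin n) K) E (MvPolynomial.X i)), φ₀ P.x)
  have h0 : ∀ q, φ₀ (algebraMap _ E q) = MvPolynomial.eval w.1 q := by
    have : (φ₀.toRingHom.comp (algebraMap (MvPolynomial (Fin n) K) E)) = MvPolynomial.eval w.1 := by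
      refine MvPolynomial.ringHom_ext (fun c => ?_) fun i => ?_
      · have := φ₀.commutes c
        rw [IsScalarTower.algebraMap_apply K (MvPolynomial (Fin n) K) E] at this
        simpa [MvPolynomial.algebraMap_eq] using this
      · simp [w]
    exact fun q => RingHom.congr_fun this q
  have h1 : ∀ q, φ₀ (Polynomial.aeval P.x q) = eval₂At q w := by
    intro q
    have := Polynomial.hom_eval₂ q (algebraMap (MvPolynomial (Fin n) K) E) φ₀.toRingHom P.x
    refine this.trans ?_
    rw [show φ₀.toRingHom.comp (algebraMap (MvPolynomial (Fin n) K) E) = MvPolynomial.eval w.1 from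
      RingHom.ext h0]
    rfl
  have hf : eval₂At P.P.f w = 0 := by rw [← h1, P.hasMap.1, map_zero]
  have hf' : eval₂At P.P.f.derivative w ≠ 0 := by
    rw [← h1]
    exact (P.hasMap.isUnit_derivative_f.map φ₀).ne_zero
  have hg : eval₂At P.P.g w ≠ 0 := by
    rw [← h1]
    exact (P.hasMap.2.map φ₀).ne_zero
  choose q k hqk using P.exists_mul_aeval_x_g_pow_eq_aeval_x
  let val : E → (Fin n → K) × K → K := fun c v => eval₂At (q c) v / eval₂At P.P.g v ^ k c
  have hval : ∀ (φ : E →ₐ[K] K) (v : (Fin n → K) × K),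
      (∀ q, φ (Polynomial.aeval P.x q) = eval₂At q v) → eval₂At P.P.g v ≠ 0 →
      ∀ c, φ c = val c v := by
    intro φ v hφ hgv c
    rw [eq_div_iff (pow_ne_zero _ hgv), ← hφ, ← hφ, ← map_pow, ← map_mul, hqk]
  have hcont : ∀ q, ContinuousAt (eval₂At q : (Fin n → K) × K → K) w :=
    fun q => (analyticAt_eval₂At q w).continuousAt
  have hW : ∀ᶠ v in 𝓝 w, eval₂At P.P.g v ≠ 0 ∧ ∀ c ∈ s, ‖val c v - φ₀ c‖ < 1 := by
    refine ((hcont _).eventually_ne hg).and ((eventually_all_finite hs).2 fun c _ => ?_)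
    have hc : ContinuousAt (val c) w := (hcont _).div ((hcont _).pow _) (pow_ne_zero _ hg)
    rw [hval φ₀ w h1 hg c]
    simpa [dist_eq_norm] using hc.eventually (Metric.ball_mem_nhds _ one_pos)
  obtain ⟨G, hG0, u, hu⟩ := exists_ne_zero_dvd_of_standardEtale P hh
  by_contra hcon
  push Not at hcon
  -- otherwise the polynomial `G`, a multiple of `h`, vanishes on a neighbourhood of `w.1`
  have hev : ∀ᶠ a in 𝓝 w.1, MvPolynomial.eval a G = 0 := by
    filter_upwards [eventually_exists_root hf hf' hW] with a ha
    obtain ⟨x, ⟨hgx, hx⟩, hfx⟩ := ha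
    obtain ⟨φ, hφ, hφ'⟩ := exists_algHom_of_root P hfx hgx
    have h2 := hcon φ fun c hc => by rw [hval φ _ hφ' hgx c]; exact hx c hc
    rw [← hφ, hu, map_mul, h2, zero_mul]
  obtain ⟨ε, hε, hball⟩ := Metric.eventually_nhds_iff_ball.1 hev
  refine hG0 (MvPolynomial.funext_set (fun i => Metric.ball (w.1 i) ε)
    (fun i => infinite_of_mem_nhds (w.1 i) (Metric.ball_mem_nhds _ hε)) fun a ha => ?_)
  rw [map_zero]
  refine hball a ?_
  rw [Metric.mem_ball, dist_pi_lt_iff hε]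
  exact fun i => ha i (Set.mem_univ i)

/-- Integral points close to a given one are dense: if `C` is an algebra of finite type over the
ring of integers `R` of `K` that maps to a standard étale algebra `E` over affine space over `K`,
the `R`-points of `C` congruent to `β` do not all satisfy an equation that is a nonzerodivisor
in `E`. -/
theorem exists_integral_point [IsUltrametricDist K] {R C E : Type*} [CommRing R] [IsLocalRing R]
    [CommRing C] [CommRing E] [Algebra R K] (hinj : Function.Injective (algebraMap R K))
    (hint : ∀ x : K, ‖x‖ ≤ 1 → ∃ c : R, algebraMap R K c = x)
    (hle : ∀ c : R, ‖algebraMap R K c‖ ≤ 1)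
    (hmax : ∀ c : R, ‖algebraMap R K c‖ < 1 → c ∈ IsLocalRing.maximalIdeal R)
    [Algebra R C] [Algebra.FiniteType R C] [Algebra K E] [Algebra (MvPolynomial (Fin n) K) E]
    [IsScalarTower K (MvPolynomial (Fin n) K) E]
    (P : StandardEtalePresentation (MvPolynomial (Fin n) K) E) (ι : C →+* E)
    (hι : ∀ c : R, ι (algebraMap R C c) = algebraMap K E (algebraMap R K c))
    (φ₀ : E →ₐ[K] K) (β : C →ₐ[R] R) (hβ : ∀ c, φ₀ (ι c) = algebraMap R K (β c))
    {h : C} (hh : ι h ∈ nonZeroDivisors E) :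
    ∃ y : C →ₐ[R] R, (∀ c, y c - β c ∈ IsLocalRing.maximalIdeal R) ∧ y h ≠ 0 := by
  obtain ⟨t, ht⟩ := Algebra.FiniteType.out (R := R) (A := C)
  obtain ⟨φ, hφ, hφh⟩ := exists_algHom_close P φ₀ (s := ι '' t) (t.finite_toSet.image _) hh
  let θ : C →ₐ[R] K :=
    { (φ.toRingHom.comp ι) with
      commutes' := fun c => by
        change φ (ι (algebraMap R C c)) = _
        rw [hι]
        exact φ.commutes _ }
  have hθ : ∀ c, θ c = φ (ι c) := fun c => rfl
  have hrange : ∀ c, ∃ b : R, algebraMap R K b = θ c := by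
    have h1 : Algebra.adjoin R (t : Set C) ≤ (Algebra.ofId R K).range.comap θ := by
      refine Algebra.adjoin_le fun c hc => ?_
      have h2 := hφ (ι c) ⟨c, hc, rfl⟩
      have h3 : ‖θ c‖ ≤ 1 := by
        have h4 := IsUltrametricDist.norm_add_le_max (φ (ι c) - φ₀ (ι c)) (φ₀ (ι c))
        rw [sub_add_cancel] at h4
        refine h4.trans (max_le h2.le ?_)
        rw [hβ]
        exact hle _
      obtain ⟨b, hb⟩ := hint _ h3
      exact ⟨b, hb⟩
    intro c
    exact h1 (ht ▸ Algebra.mem_top : c ∈ Algebra.adjoin R (t : Set C))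
  choose y hy using hrange
  have hyeq : ∀ {b : R} {c : C}, algebraMap R K b = θ c → y c = b := fun hb =>
    hinj ((hy _).trans hb.symm)
  let Y : C →ₐ[R] R :=
    { toFun := y
      map_one' := hyeq (by rw [map_one, map_one])
      map_mul' := fun a b => hyeq (by rw [map_mul, map_mul, hy, hy])
      map_zero' := hyeq (by rw [map_zero, map_zero])
      map_add' := fun a b => hyeq (by rw [map_add, map_add, hy, hy])
      commutes' := fun c => hyeq (θ.commutes c).symm }
  refine ⟨Y, fun c => ?_, fun h0 => hφh ?_⟩
  · let ρ := (IsScalarTower.toAlgHom R R (IsLocalRing.ResidueField R))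
    have h1 : ρ.comp Y = ρ.comp β := by
      refine AlgHom.ext_of_adjoin_eq_top ht fun c hc => ?_
      have h2 := hφ (ι c) ⟨c, hc, rfl⟩
      rw [hβ, ← hθ, ← hy, ← map_sub] at h2
      have h3 := hmax _ h2
      rw [← IsLocalRing.residue_eq_zero_iff, map_sub, sub_eq_zero] at h3
      exact h3
    rw [← IsLocalRing.residue_eq_zero_iff, map_sub, sub_eq_zero]
    exact AlgHom.congr_fun h1 c
  · rw [← hθ, ← hy]
    change algebraMap R K (Y h) = 0
    rw [h0, map_zero]

end Density

/-! ### Arithmetic of the ring of integers -/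

section RingOfIntegersArithmetic

variable (p : ℕ) [Fact p.Prime] (K : Type u) [Field K] [Algebra ℚ_[p] K]

theorem spectralNorm_natCast_lt_one : spectralNorm ℚ_[p] K (p : K) < 1 := by
  have h := spectralNorm_extends (K := ℚ_[p]) (L := K) (p : ℚ_[p])
  rw [map_natCast] at h
  rw [h]
  exact Padic.norm_p_lt_one

variable [Algebra ℤ_[p] K] [IsScalarTower ℤ_[p] ℚ_[p] K]

theorem faithfulSMul_ringOfIntegers : FaithfulSMul ℤ_[p] (integralClosure ℤ_[p] K) := by
  have h1 : Function.Injective (algebraMap ℤ_[p] K) := by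
    rw [IsScalarTower.algebraMap_eq ℤ_[p] ℚ_[p] K]
    exact (algebraMap ℚ_[p] K).injective.comp (IsFractionRing.injective ℤ_[p] ℚ_[p])
  rw [faithfulSMul_iff_algebraMap_injective]
  rw [IsScalarTower.algebraMap_eq ℤ_[p] (integralClosure ℤ_[p] K) K, RingHom.coe_comp] at h1
  exact h1.of_comp

theorem natCast_ne_zero_ringOfIntegers : (p : integralClosure ℤ_[p] K) ≠ 0 := by
  have := faithfulSMul_ringOfIntegers p K
  rw [← map_natCast (algebraMap ℤ_[p] (integralClosure ℤ_[p] K)), Ne,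
    map_eq_zero_iff _ (FaithfulSMul.algebraMap_injective _ _)]
  exact_mod_cast (Fact.out : p.Prime).ne_zero

variable [FiniteDimensional ℚ_[p] K]

theorem isDedekindDomain_ringOfIntegers : IsDedekindDomain (integralClosure ℤ_[p] K) :=
  integralClosure.isDedekindDomain ℤ_[p] ℚ_[p] K

theorem moduleFinite_ringOfIntegers : Module.Finite ℤ_[p] (integralClosure ℤ_[p] K) :=
  IsIntegralClosure.finite ℤ_[p] ℚ_[p] K (integralClosure ℤ_[p] K)

theorem finite_residueField_ringOfIntegers :
    Finite (IsLocalRing.ResidueField (integralClosure ℤ_[p] K)) := by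
  have := moduleFinite_ringOfIntegers p K
  have := faithfulSMul_ringOfIntegers p K
  have : IsLocalHom (algebraMap ℤ_[p] (integralClosure ℤ_[p] K)) := inferInstance
  have : Finite (IsLocalRing.ResidueField ℤ_[p]) := inferInstance
  exact IsLocalRing.ResidueField.finite_of_finite (R := ℤ_[p]) this

/-- There is a uniformizer `ϖ`, and the ramification index `e` satisfies `(p) = (ϖ ^ e)`. -/
theorem exists_uniformizer {e : ℕ}
    (he : e = (IsLocalRing.maximalIdeal (integralClosure ℤ_[p] K)).ramificationIdx ℤ_[p]) :
    e ≠ 0 ∧ ∃ ϖ : integralClosure ℤ_[p] K,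
      IsLocalRing.maximalIdeal (integralClosure ℤ_[p] K) = Ideal.span {ϖ} ∧
      ϖ ^ e ∣ (p : integralClosure ℤ_[p] K) ∧ (p : integralClosure ℤ_[p] K) ∣ ϖ ^ e := by
  have := isDedekindDomain_ringOfIntegers p K
  have := moduleFinite_ringOfIntegers p K
  have := faithfulSMul_ringOfIntegers p K
  have : IsLocalHom (algebraMap ℤ_[p] (integralClosure ℤ_[p] K)) := inferInstance
  have hp0 := natCast_ne_zero_ringOfIntegers p K
  have hmap : (IsLocalRing.maximalIdeal ℤ_[p]).map (algebraMap ℤ_[p] (integralClosure ℤ_[p] K))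
      = Ideal.span {(p : integralClosure ℤ_[p] K)} := by
    rw [PadicInt.maximalIdeal_eq_span_p, Ideal.map_span, Set.image_singleton, map_natCast]
  have hpm : (p : integralClosure ℤ_[p] K) ∈ IsLocalRing.maximalIdeal _ := by
    rw [← Ideal.span_singleton_le_iff_mem, ← hmap]
    exact IsLocalRing.map_maximalIdeal_le _
  have hnf : ¬ IsField (integralClosure ℤ_[p] K) := fun h => by
    rw [IsLocalRing.isField_iff_maximalIdeal_eq.1 h, Ideal.mem_bot] at hpm
    exact hp0 hpm
  have hiff : IsDiscreteValuationRing (integralClosure ℤ_[p] K) ↔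
      IsDedekindDomain (integralClosure ℤ_[p] K) :=
    (IsDiscreteValuationRing.TFAE (integralClosure ℤ_[p] K) hnf).out 0 2
  have hdvr : IsDiscreteValuationRing (integralClosure ℤ_[p] K) := hiff.2 inferInstance
  obtain ⟨ϖ, hϖ⟩ := IsDiscreteValuationRing.exists_irreducible (integralClosure ℤ_[p] K)
  have hmax := hϖ.maximalIdeal_eq
  obtain ⟨n, hn⟩ := IsDiscreteValuationRing.ideal_eq_span_pow_irreducible
    (s := Ideal.span {(p : integralClosure ℤ_[p] K)})
    (by rwa [Ne, Ideal.span_singleton_eq_bot]) hϖ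
  have hlies : (IsLocalRing.maximalIdeal (integralClosure ℤ_[p] K)).LiesOver
      (IsLocalRing.maximalIdeal ℤ_[p]) := inferInstance
  have hen : e = n := by
    rw [he, Ideal.IsDedekindDomain.ramificationIdx_eq_multiplicity (IsLocalRing.maximalIdeal ℤ_[p])
      _ (by rw [hmap]; rwa [Ne, Ideal.span_singleton_eq_bot]), hmap, hn, ← Ideal.span_singleton_pow,
      ← hmax]
    exact multiplicity_pow_self (IsDiscreteValuationRing.not_a_field _)
      (by rw [Ideal.isUnit_iff]; exact Ideal.IsPrime.ne_top inferInstance) n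
  rw [← hen] at hn
  refine ⟨?_, ϖ, hmax, ?_, ?_⟩
  · rintro h0
    rw [h0, pow_zero, Ideal.span_singleton_eq_span_singleton] at hn
    exact (mem_nonunits_iff.1 hpm) (hn.symm.isUnit isUnit_one)
  · rw [← Ideal.mem_span_singleton, ← hn]
    exact Ideal.mem_span_singleton_self _
  · rw [← Ideal.mem_span_singleton, hn]
    exact Ideal.mem_span_singleton_self _

theorem mem_maximalIdeal_of_spectralNorm_lt_one {x : integralClosure ℤ_[p] K}
    (hx : spectralNorm ℚ_[p] K x < 1) : x ∈ IsLocalRing.maximalIdeal (integralClosure ℤ_[p] K) := by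
  rw [IsLocalRing.mem_maximalIdeal, mem_nonunits_iff]
  rintro ⟨v, rfl⟩
  have h2 := (mem_ringOfIntegers_iff p K _).1 (↑v⁻¹ : integralClosure ℤ_[p] K).2
  have h3 := spectralAlgNorm_mul (K := ℚ_[p]) (L := K) (v : integralClosure ℤ_[p] K)
    (↑v⁻¹ : integralClosure ℤ_[p] K)
  rw [← MulMemClass.coe_mul, Units.mul_inv, OneMemClass.coe_one, spectralAlgNorm_def,
    spectralAlgNorm_def, spectralAlgNorm_def, spectralNorm_one] at h3
  have h4 := spectralNorm_nonneg (K := ℚ_[p]) ((v : integralClosure ℤ_[p] K) : K)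
  nlinarith

/-- The recurrence principle `exists_pow_eval_eq_zero` over the ring of integers of a finite
extension of `ℚ_[p]`, with the absolute value given by the spectral norm. -/
theorem exists_pow_eval_eq_zero_ringOfIntegers {e r g : ℕ}
    (he : e = (IsLocalRing.maximalIdeal (integralClosure ℤ_[p] K)).ramificationIdx ℤ_[p])
    (hr : e < 2 ^ r * (p - 1)) {A : Type*} [CommRing A] [IsLocalRing A]
    [Algebra (integralClosure ℤ_[p] K) A] [IsLocalHom (algebraMap (integralClosure ℤ_[p] K) A)]
    (hsurj : ∀ a : A, ∃ c : integralClosure ℤ_[p] K,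
      a - algebraMap _ A c ∈ IsLocalRing.maximalIdeal A)
    {d : ℕ} (hdg : d ≤ g) {x : Fin d → A}
    (hx : IsLocalRing.maximalIdeal A =
      (IsLocalRing.maximalIdeal (integralClosure ℤ_[p] K)).map (algebraMap _ A) ⊔
        Ideal.span (Set.range x))
    {ψ : A →ₐ[integralClosure ℤ_[p] K] A}
    (hψ : IsLocalRing.maximalIdeal A = (IsLocalRing.maximalIdeal A).map ψ) :
    ∃ N, 0 < N ∧
      N ≤ Nat.card (GL (Fin g) (IsLocalRing.ResidueField (integralClosure ℤ_[p] K))) ∧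
      ∀ ζ : A →ₐ[integralClosure ℤ_[p] K] integralClosure ℤ_[p] K, IsLocalHom ζ.toRingHom →
        ∀ a : A, {n : ℕ | ζ (((ψ.toLinearMap ^ (N * p ^ (1 + r))) ^ n) a) = 0}.Infinite →
          ∀ n, ζ (((ψ.toLinearMap ^ (N * p ^ (1 + r))) ^ n) a) = 0 := by
  let N₀ : NontriviallyNormedField K := spectralNorm.nontriviallyNormedField ℚ_[p] K
  have hultra : IsUltrametricDist K :=
    IsUltrametricDist.isUltrametricDist_of_isNonarchimedean_norm
      (isNonarchimedean_spectralNorm (K := ℚ_[p]) (L := K))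
  have hcomp : CompleteSpace K := spectralNorm.completeSpace ℚ_[p] K
  have hchar : CharZero K := charZero_of_injective_algebraMap (algebraMap ℚ_[p] K).injective
  have := finite_residueField_ringOfIntegers p K
  obtain ⟨he0, ϖ, hmax, hϖp, hpϖ⟩ := exists_uniformizer p K he
  have hle : ∀ c : integralClosure ℤ_[p] K, ‖algebraMap (integralClosure ℤ_[p] K) K c‖ ≤ 1 :=
    fun c => (mem_ringOfIntegers_iff p K (c : K)).1 c.2
  have hpn : ‖(p : K)‖ < 1 := spectralNorm_natCast_lt_one p K
  have hϖe : ‖algebraMap (integralClosure ℤ_[p] K) K ϖ‖ ^ e ≤ ‖(p : K)‖ := by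
    obtain ⟨c, hc⟩ := hpϖ
    rw [← norm_pow, ← map_pow, hc, map_mul, norm_mul, map_natCast]
    exact mul_le_of_le_one_right (norm_nonneg _) (hle c)
  have hϖ : ‖algebraMap (integralClosure ℤ_[p] K) K ϖ‖ < 1 := by
    by_contra h
    exact absurd (hϖe.trans_lt hpn) (not_lt.2 (one_le_pow₀ (not_lt.1 h)))
  have hϖm : algebraMap (integralClosure ℤ_[p] K) A ϖ ∈ IsLocalRing.maximalIdeal A := by
    have h1 : ϖ ∈ IsLocalRing.maximalIdeal (integralClosure ℤ_[p] K) :=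
      hmax ▸ Ideal.mem_span_singleton_self ϖ
    exact IsLocalRing.map_maximalIdeal_le (algebraMap _ A) (Ideal.mem_map_of_mem _ h1)
  have hx' : IsLocalRing.maximalIdeal A
      = Ideal.span (insert (algebraMap (integralClosure ℤ_[p] K) A ϖ) (Set.range x)) := by
    rw [hx, hmax, Ideal.map_span, Set.image_singleton, ← Ideal.span_union, Set.singleton_union]
  obtain ⟨N, hN0, hN, h⟩ := exists_pow_eval_eq_zero (K := K) hpn
    (FaithfulSMul.algebraMap_injective (integralClosure ℤ_[p] K) K) hle hϖ he0 hϖe hϖp hr hmax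
    hϖm hsurj hdg hx' hψ
  refine ⟨N, hN0, hN, fun ζ hζ => h ζ fun a ha => ?_⟩
  rw [← hmax]
  exact IsLocalRing.map_maximalIdeal_le ζ.toRingHom (Ideal.mem_map_of_mem ζ.toRingHom ha)

/-- The density statement `exists_integral_point` over the ring of integers of a finite extension
of `ℚ_[p]`, with the absolute value given by the spectral norm. -/
theorem exists_integral_point_ringOfIntegers {n : ℕ} {C E : Type*} [CommRing C] [CommRing E]
    [Algebra (integralClosure ℤ_[p] K) C] [Algebra.FiniteType (integralClosure ℤ_[p] K) C]
    [Algebra K E] [Algebra (MvPolynomial (Fin n) K) E]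
    [IsScalarTower K (MvPolynomial (Fin n) K) E]
    (P : StandardEtalePresentation (MvPolynomial (Fin n) K) E) (ι : C →+* E)
    (hι : ∀ c : integralClosure ℤ_[p] K, ι (algebraMap _ C c) = algebraMap K E c)
    (φ₀ : E →ₐ[K] K) (β : C →ₐ[integralClosure ℤ_[p] K] integralClosure ℤ_[p] K)
    (hβ : ∀ c, φ₀ (ι c) = β c) {h : C} (hh : ι h ∈ nonZeroDivisors E) :
    ∃ y : C →ₐ[integralClosure ℤ_[p] K] integralClosure ℤ_[p] K,
      (∀ c, y c - β c ∈ IsLocalRing.maximalIdeal (integralClosure ℤ_[p] K)) ∧ y h ≠ 0 := by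
  let N₀ : NontriviallyNormedField K := spectralNorm.nontriviallyNormedField ℚ_[p] K
  have hultra : IsUltrametricDist K :=
    IsUltrametricDist.isUltrametricDist_of_isNonarchimedean_norm
      (isNonarchimedean_spectralNorm (K := ℚ_[p]) (L := K))
  have hcomp : CompleteSpace K := spectralNorm.completeSpace ℚ_[p] K
  refine exists_integral_point (K := K) (E := E)
    (FaithfulSMul.algebraMap_injective (integralClosure ℤ_[p] K) K)
    (fun x hx => ⟨⟨x, (mem_ringOfIntegers_iff p K x).2 hx⟩, rfl⟩)
    (fun c => (mem_ringOfIntegers_iff p K (c : K)).1 c.2)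
    (fun c hc => mem_maximalIdeal_of_spectralNorm_lt_one p K hc) P ι hι φ₀ β hβ hh

end RingOfIntegersArithmetic

/-! ### Charts and stalks of smooth schemes -/

section Charts

/-- A morphism into a scheme whose image lies in an affine open subset is given by a ring
homomorphism, which is flat if the morphism is. -/
theorem exists_specMap_fromSpec {Y : Scheme.{u}} {U : Y.Opens} (hU : IsAffineOpen U)
    {E : CommRingCat.{u}} (f : Spec E ⟶ Y) (hf : Set.range f ⊆ U) :
    ∃ ι : Γ(Y, U) ⟶ E, Spec.map ι ≫ hU.fromSpec = f ∧ (Flat f → ι.hom.Flat) := by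
  have e : (⊤ : (Spec E).Opens) ≤ f ⁻¹ᵁ U := fun x _ => hf ⟨x, rfl⟩
  refine ⟨f.appLE U ⊤ e ≫ (Scheme.ΓSpecIso E).hom, ?_, ?_⟩
  · have h1 := IsAffineOpen.SpecMap_appLE_fromSpec f hU (isAffineOpen_top _) e
    rw [Spec.map_comp, Category.assoc, h1, IsAffineOpen.fromSpec_top, Scheme.isoSpec_Spec_inv,
      ← Category.assoc, ← Spec.map_comp]
    simp
  · intro _
    have h1 := Flat.flat_appLE f hU (isAffineOpen_top _) e
    exact (RingHom.Flat.respectsIso.1) _ (Scheme.ΓSpecIso E).commRingCatIsoToRingEquiv h1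

/-- A smooth morphism to an affine scheme is, locally on the source, standard étale over an affine
space. -/
theorem exists_standardEtale_chart {Z : Scheme.{u}} {R : Type u} [CommRing R]
    (φ : Z ⟶ Spec (.of R)) [AlgebraicGeometry.Smooth φ] (x : Z) :
    ∃ (n : ℕ) (E : Type u) (_ : CommRing E) (_ : Algebra R E)
      (_ : Algebra (MvPolynomial (Fin n) R) E) (_ : IsScalarTower R (MvPolynomial (Fin n) R) E)
      (_ : Algebra.IsStandardEtale (MvPolynomial (Fin n) R) E) (j : Spec (.of E) ⟶ Z),
      IsOpenImmersion j ∧ x ∈ Set.range j ∧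
        j ≫ φ = Spec.map (CommRingCat.ofHom (algebraMap R E)) := by
  obtain ⟨_, ⟨V, hV, rfl⟩, hxV, -⟩ := Z.isBasis_affineOpens.exists_subset_of_mem_open
    (Set.mem_univ x) isOpen_univ
  replace hV : IsAffineOpen V := hV
  obtain ⟨ψ, hψ⟩ := Spec.map_surjective (hV.fromSpec ≫ φ)
  have hsm : AlgebraicGeometry.Smooth (Spec.map ψ) := hψ ▸ inferInstance
  rw [HasRingHomProperty.Spec_iff (P := @AlgebraicGeometry.Smooth)] at hsm
  algebraize [ψ.hom]
  have hsm' : Algebra.Smooth R Γ(Z, V) := hsm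
  have hxr : x ∈ Set.range hV.fromSpec := by rw [hV.range_fromSpec]; exact hxV
  obtain ⟨q, hq⟩ := hxr
  have hqp : q.asIdeal.IsPrime := q.isPrime
  obtain ⟨t, ht, n, i1, i2, i3⟩ :=
    Algebra.IsSmoothAt.exists_isStandardEtale_mvPolynomial (R := R) (p := q.asIdeal)
  refine ⟨n, Localization.Away t, inferInstance, inferInstance, i1, i2, i3,
    Spec.map (CommRingCat.ofHom (algebraMap Γ(Z, V) (Localization.Away t))) ≫ hV.fromSpec,
    inferInstance, ?_, ?_⟩
  · have : q ∈ Set.range (PrimeSpectrum.comap (algebraMap Γ(Z, V) (Localization.Away t))) := by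
      rw [PrimeSpectrum.localization_away_comap_range _ t]
      exact ht
    obtain ⟨q', hq'⟩ := this
    refine ⟨q', ?_⟩
    refine (Scheme.Hom.comp_apply _ _ _).trans ?_
    exact (congrArg _ hq').trans hq
  · rw [Category.assoc, ← hψ, ← Spec.map_comp]
    rfl

/-- A morphism from the spectrum of a local ring factors through an open immersion as soon as its
closed point lands in the image. -/
theorem exists_factor_of_closedPoint_mem {X Z : Scheme.{u}} {L : Type u} [CommRing L]
    [IsLocalRing L] (z : Spec (.of L) ⟶ X) (j : Z ⟶ X) [IsOpenImmersion j]
    (h : z (IsLocalRing.closedPoint L) ∈ Set.range j) : ∃ w : Spec (.of L) ⟶ Z, w ≫ j = z := by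
  have hrange : Set.range z ⊆ Set.range j := by
    rintro _ ⟨q, rfl⟩
    exact ((IsLocalRing.specializes_closedPoint q).map z.continuous).mem_open
      j.isOpenEmbedding.isOpen_range h
  exact ⟨IsOpenImmersion.lift j z hrange, IsOpenImmersion.lift_fac _ _ _⟩

/-- A morphism from the spectrum of a local ring with closed point `x` is given by a local
homomorphism on the stalk at `x`. -/
theorem exists_specMap_fromSpecStalk {X : Scheme.{u}} {L : CommRingCat.{u}} [IsLocalRing L]
    (z : Spec L ⟶ X) {x : X} (h : z (IsLocalRing.closedPoint L) = x) :
    ∃ ζ : X.presheaf.stalk x ⟶ L, IsLocalHom ζ.hom ∧ Spec.map ζ ≫ X.fromSpecStalk x = z := by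
  subst h
  exact ⟨Scheme.stalkClosedPointTo z, inferInstance, Scheme.Spec_stalkClosedPointTo_fromSpecStalk z⟩

/-- An unramified endomorphism fixing `x` induces an endomorphism of the stalk at `x` that carries
the maximal ideal to a generating set of the maximal ideal. -/
theorem exists_stalk_endomorphism {X Y : Scheme.{u}} (Ψ : X ⟶ Y) [AlgebraicGeometry.Etale Ψ]
    {x : X} {y : Y} (h : Ψ x = y) :
    ∃ ψ : Y.presheaf.stalk y ⟶ X.presheaf.stalk x,
      Spec.map ψ ≫ Y.fromSpecStalk y = X.fromSpecStalk x ≫ Ψ ∧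
      (IsLocalRing.maximalIdeal (Y.presheaf.stalk y)).map ψ.hom
        = IsLocalRing.maximalIdeal (X.presheaf.stalk x) := by
  subst h
  refine ⟨Ψ.stalkMap x, Scheme.SpecMap_stalkMap_fromSpecStalk Ψ, ?_⟩
  algebraize [(Ψ.stalkMap x).hom]
  have : IsLocalHom (algebraMap (Y.presheaf.stalk (Ψ x)) (X.presheaf.stalk x)) :=
    inferInstanceAs <| IsLocalHom (Ψ.stalkMap x).hom
  have : Algebra.EssFiniteType (Y.presheaf.stalk (Ψ x)) (X.presheaf.stalk x) := by
    rw [← RingHom.essFiniteType_algebraMap, RingHom.algebraMap_toAlgebra]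
    exact LocallyOfFiniteType.stalkMap Ψ x
  have : Algebra.FormallyUnramified (Y.presheaf.stalk (Ψ x)) (X.presheaf.stalk x) := by
    rw [← RingHom.formallyUnramified_algebraMap, RingHom.algebraMap_toAlgebra]
    exact FormallyUnramified.stalkMap Ψ x
  exact Algebra.FormallyUnramified.map_maximalIdeal

theorem map_algebraMap_stalk_eq_maximalIdeal (B : Type u) [CommRing B] (y : PrimeSpectrum B)
    [IsLocalRing ((AlgebraicGeometry.Spec.structureSheaf B).presheaf.stalk y)] :
    y.asIdeal.map (algebraMap B ((AlgebraicGeometry.Spec.structureSheaf B).presheaf.stalk y)) =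
      IsLocalRing.maximalIdeal ((AlgebraicGeometry.Spec.structureSheaf B).presheaf.stalk y) :=
  IsLocalization.AtPrime.map_eq_maximalIdeal y.asIdeal
    ((AlgebraicGeometry.Spec.structureSheaf B).presheaf.stalk y)

/-- The maximal ideal of the stalk of an affine scheme at a prime is generated by the prime. -/
theorem exists_map_eq_maximalIdeal_stalk (B : CommRingCat.{u}) (y : Spec B) :
    ∃ τ : B ⟶ (Spec B).presheaf.stalk y, (Spec B).fromSpecStalk y = Spec.map τ ∧
      y.asIdeal.map τ.hom = IsLocalRing.maximalIdeal ((Spec B).presheaf.stalk y) := by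
  refine ⟨_, Spec.fromSpecStalk_eq' B y, ?_⟩
  have : IsLocalRing ((AlgebraicGeometry.Spec.structureSheaf B).presheaf.stalk y) :=
    inferInstanceAs (IsLocalRing ((Spec B).presheaf.stalk y))
  exact map_algebraMap_stalk_eq_maximalIdeal B y

/-- In a chart that is étale over a ring `B`, the maximal ideal of the stalk is generated by its
contraction to `B`. -/
theorem exists_chart_to_stalk {X : Scheme.{u}} {B E : CommRingCat.{u}} (σ : B ⟶ E)
    (hσ : σ.hom.Etale) (j : Spec E ⟶ X) [IsOpenImmersion j] {x : X} (hx : x ∈ Set.range j) :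
    ∃ ε : E ⟶ X.presheaf.stalk x, Spec.map ε ≫ j = X.fromSpecStalk x ∧
      IsLocalRing.maximalIdeal (X.presheaf.stalk x) =
        ((IsLocalRing.maximalIdeal (X.presheaf.stalk x)).comap (σ ≫ ε).hom).map (σ ≫ ε).hom := by
  obtain ⟨q, rfl⟩ := hx
  have hh : AlgebraicGeometry.Etale (Spec.map σ) := by
    rwa [HasRingHomProperty.Spec_iff (P := @AlgebraicGeometry.Etale)]
  obtain ⟨ψ, hψ1, hψ2⟩ := exists_stalk_endomorphism (Spec.map σ) (x := q) rfl
  have hj := Scheme.SpecMap_stalkMap_fromSpecStalk j (x := q)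
  have hi : (IsLocalRing.maximalIdeal ((Spec E).presheaf.stalk q)).map
      (inv (j.stalkMap q)).hom = IsLocalRing.maximalIdeal (X.presheaf.stalk (j q)) :=
    IsLocalRing.map_maximalIdeal_of_surjective _
      (ConcreteCategory.bijective_of_isIso (inv (j.stalkMap q))).2
  obtain ⟨τ, hτ, hB⟩ := exists_map_eq_maximalIdeal_stalk B (Spec.map σ q)
  obtain ⟨τ', hτ', -⟩ := exists_map_eq_maximalIdeal_stalk E q
  have hε : Spec.map (τ' ≫ inv (j.stalkMap q)) ≫ j = X.fromSpecStalk (j q) := by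
    rw [Spec.map_comp, Category.assoc, ← hτ', ← hj, ← Category.assoc, ← Spec.map_comp]
    simp
  have hψε : σ ≫ τ' ≫ inv (j.stalkMap q) = τ ≫ ψ ≫ inv (j.stalkMap q) := by
    have : τ ≫ ψ = σ ≫ τ' := by
      apply Spec.map_injective
      rw [Spec.map_comp, Spec.map_comp, ← hτ, ← hτ']
      exact hψ1
    rw [← Category.assoc, ← this, Category.assoc]
  have key : IsLocalRing.maximalIdeal (X.presheaf.stalk (j q)) =
      (Spec.map σ q).asIdeal.map (σ ≫ τ' ≫ inv (j.stalkMap q)).hom := by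
    rw [hψε, CommRingCat.hom_comp, CommRingCat.hom_comp, ← Ideal.map_map, ← Ideal.map_map, hB,
      hψ2, hi]
  refine ⟨_, hε, le_antisymm ?_ Ideal.map_comap_le⟩
  conv_lhs => rw [key]
  refine Ideal.map_mono ?_
  rw [← Ideal.map_le_iff_le_comap, ← key]

end Charts

/-! ### Generators of the maximal ideal at an integral point -/

section Cotangent

/-- The prime ideals `(X₀ - b₀, …, X_{i-1} - b_{i-1})` of a polynomial ring. -/
noncomputable def coordinatePrime {n : ℕ} {R : Type*} [CommRing R] [IsDomain R] (b : Fin n → R)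
    (i : ℕ) : PrimeSpectrum (MvPolynomial (Fin n) R) :=
  ⟨RingHom.ker (MvPolynomial.aeval (R := R) fun j : Fin n =>
    if j.val < i then MvPolynomial.C (b j) else MvPolynomial.X j), RingHom.ker_isPrime _⟩

theorem mem_coordinatePrime_iff {n : ℕ} {R : Type*} [CommRing R] [IsDomain R] {b : Fin n → R}
    {i : ℕ} {P : MvPolynomial (Fin n) R} :
    P ∈ (coordinatePrime b i).asIdeal ↔ MvPolynomial.aeval (R := R) (fun j : Fin n =>
      if j.val < i then MvPolynomial.C (b j) else MvPolynomial.X j) P = 0 :=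
  Iff.rfl

theorem coordinatePrime_lt_succ {n : ℕ} {R : Type*} [CommRing R] [IsDomain R] (b : Fin n → R)
    (i : Fin n) : coordinatePrime b i.val < coordinatePrime b (i.val + 1) := by
  rw [← PrimeSpectrum.asIdeal_lt_asIdeal]
  refine lt_of_le_of_ne (fun P hP => ?_) fun h => ?_
  · rw [mem_coordinatePrime_iff] at hP ⊢
    have := congrArg (MvPolynomial.aeval (R := R) fun j : Fin n =>
      if j.val < i.val + 1 then MvPolynomial.C (σ := Fin n) (b j) else MvPolynomial.X j) hP
    rw [map_zero, ← AlgHom.comp_apply] at this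
    rw [← this]
    congr 1
    ext1 j
    simp only [MvPolynomial.aeval_X, AlgHom.comp_apply]
    by_cases h1 : j.val < i.val
    · simp [h1, h1.trans (Nat.lt_succ_self _)]
    · simp [h1]
  · have h1 : (MvPolynomial.X i - MvPolynomial.C (b i) : MvPolynomial (Fin n) R) ∈
        (coordinatePrime b (i.val + 1)).asIdeal := by
      rw [mem_coordinatePrime_iff]
      simp
    rw [← h, mem_coordinatePrime_iff] at h1
    simp only [map_sub, MvPolynomial.aeval_X, lt_irrefl, if_false, MvPolynomial.aeval_C,
      MvPolynomial.algebraMap_eq] at h1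
    have := congrArg (MvPolynomial.coeff (Finsupp.single i 1)) h1
    rw [MvPolynomial.coeff_sub, MvPolynomial.coeff_X, MvPolynomial.coeff_C,
      if_neg (Finsupp.single_ne_zero.2 one_ne_zero).symm] at this
    simp at this

/-- By going down, a ring that is flat over a polynomial ring in `n` variables and has a point over
a rational point of affine space has dimension at least `n`. -/
theorem natCast_le_ringKrullDim_of_flat {n : ℕ} {R S k : Type*} [CommRing R] [IsDomain R]
    [CommRing S] [CommRing k] [IsDomain k] [Algebra (MvPolynomial (Fin n) R) S]
    [Module.Flat (MvPolynomial (Fin n) R) S] (φ : S →+* k) (b : Fin n → R)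
    (hφ : ∀ P : MvPolynomial (Fin n) R,
      φ (algebraMap _ S P) = 0 ↔ MvPolynomial.eval b P = 0) :
    (n : WithBot ℕ∞) ≤ ringKrullDim S := by
  let l : LTSeries (PrimeSpectrum (MvPolynomial (Fin n) R)) :=
    LTSeries.mk n (fun i => coordinatePrime b i.val)
      (Fin.strictMono_iff_lt_succ.2 fun i => by
        simpa using coordinatePrime_lt_succ b i)
  have hlast : l.last = coordinatePrime b n := rfl
  have : (RingHom.ker φ).IsPrime := RingHom.ker_isPrime φ
  have lo : (RingHom.ker φ).LiesOver l.last.asIdeal := by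
    constructor
    ext P
    rw [hlast, mem_coordinatePrime_iff, Ideal.under_def, Ideal.mem_comap, RingHom.mem_ker, hφ]
    have h1 : (MvPolynomial.aeval (R := R) fun j : Fin n =>
        if j.val < n then MvPolynomial.C (σ := Fin n) (b j) else MvPolynomial.X j) P
        = MvPolynomial.C (MvPolynomial.eval b P) := by
      have h2 : (MvPolynomial.aeval (R := R) fun j : Fin n =>
          if j.val < n then MvPolynomial.C (σ := Fin n) (b j) else MvPolynomial.X j)
          = (Algebra.ofId R (MvPolynomial (Fin n) R)).comp (MvPolynomial.aeval b) := by
        ext1 j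
        simp [Algebra.ofId_apply, MvPolynomial.algebraMap_eq]
      rw [h2]
      simp [Algebra.ofId_apply, MvPolynomial.algebraMap_eq, MvPolynomial.aeval_eq_eval]
    rw [h1]
    simp
  obtain ⟨L, hL, -⟩ := Ideal.exists_ltSeries_of_hasGoingDown l (RingHom.ker φ)
  have h := Order.LTSeries.length_le_krullDim L
  rw [hL] at h
  exact h

/-- The relative dimension of a standard étale chart of a scheme over a domain with fraction field
`K` is at most the dimension of the generic fiber, if the chart contains an integral point. -/
theorem natCast_le_topologicalKrullDim_genericFiber {R : Type u} [CommRing R] [IsDomain R]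
    (K : Type u) [Field K] [Algebra R K] [IsFractionRing R K] {X : Scheme.{u}}
    (f : X ⟶ Spec (.of R)) {n : ℕ} {E : Type u} [CommRing E] [Algebra R E]
    [Algebra (MvPolynomial (Fin n) R) E] [IsScalarTower R (MvPolynomial (Fin n) R) E]
    [Module.Flat (MvPolynomial (Fin n) R) E] (j : Spec (.of E) ⟶ X) [IsOpenImmersion j]
    (hj : j ≫ f = Spec.map (CommRingCat.ofHom (algebraMap R E))) (ζ : E →ₐ[R] R) :
    (n : WithBot ℕ∞) ≤ topologicalKrullDim (genericFiber K f) := by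
  let M := Algebra.algebraMapSubmonoid E (nonZeroDivisors R)
  let E' := Localization M
  have hu : ∀ y : nonZeroDivisors R, IsUnit (algebraMap R E' y) := fun y => by
    rw [IsScalarTower.algebraMap_apply R E E']
    exact IsLocalization.map_units E' (⟨_, Algebra.mem_algebraMapSubmonoid_of_mem y⟩ : M)
  let κ : K →+* E' := IsLocalization.lift (M := nonZeroDivisors R) hu
  have hκ : κ.comp (algebraMap R K) = (algebraMap E E').comp (algebraMap R E) := by
    rw [← IsScalarTower.algebraMap_eq]
    exact IsLocalization.lift_comp hu
  let a : Spec (.of E') ⟶ X := Spec.map (CommRingCat.ofHom (algebraMap E E')) ≫ j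
  let h : Spec (.of E') ⟶ genericFiber K f :=
    pullback.lift a (Spec.map (CommRingCat.ofHom κ)) (by
      rw [Category.assoc, hj, ← Spec.map_comp, ← Spec.map_comp, ← CommRingCat.ofHom_comp,
        ← CommRingCat.ofHom_comp, hκ])
  have hh : h ≫ pullback.fst _ _ = a := pullback.lift_fst _ _ _
  have hind : Topology.IsInducing h := by
    refine Topology.IsInducing.of_comp h.continuous (Scheme.Hom.continuous (pullback.fst _ _)) ?_
    have h1 : Topology.IsInducing a := by
      refine j.isOpenEmbedding.isInducing.comp ?_
      exact PrimeSpectrum.localization_comap_isInducing E' M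
    rw [← hh] at h1
    exact h1
  refine le_trans ?_ hind.topologicalKrullDim_le
  have h2 : topologicalKrullDim (Spec (.of E')) = ringKrullDim E' :=
    PrimeSpectrum.topologicalKrullDim_eq_ringKrullDim _
  rw [h2]
  have hv : ∀ y : M, IsUnit (((algebraMap R K).comp ζ.toRingHom) y) := by
    rintro ⟨_, y, hy, rfl⟩
    change IsUnit (algebraMap R K (ζ (algebraMap R E y)))
    rw [ζ.commutes]
    exact IsLocalization.map_units K (⟨y, hy⟩ : nonZeroDivisors R)
  have : Module.Flat E E' := IsLocalization.flat E' M
  have : Module.Flat (MvPolynomial (Fin n) R) E' := Module.Flat.trans _ E _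
  refine natCast_le_ringKrullDim_of_flat (IsLocalization.lift hv : E' →+* K)
    (fun i => ζ (algebraMap (MvPolynomial (Fin n) R) E (MvPolynomial.X i))) fun P => ?_
  have h3 : ζ (algebraMap _ E P)
      = MvPolynomial.eval
          (fun i => ζ (algebraMap (MvPolynomial (Fin n) R) E (MvPolynomial.X i))) P := by
    rw [← MvPolynomial.aeval_eq_eval]
    change (ζ.comp (IsScalarTower.toAlgHom R (MvPolynomial (Fin n) R) E)) P = _
    congr 1
    ext1 i
    simp
  have h4 : (IsLocalization.lift hv : E' →+* K) (algebraMap (MvPolynomial (Fin n) R) E' P)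
      = algebraMap R K (ζ (algebraMap _ E P)) := IsLocalization.lift_eq hv _
  rw [h4, h3, map_eq_zero_iff _ (IsFractionRing.injective R K)]

/-- At an integral point of a smooth scheme over a local domain `R`, the maximal ideal of the local
ring is generated by that of `R` together with at most `g` elements, where `g` is the dimension of
the generic fiber. -/
theorem exists_generators_maximalIdeal_stalk {R : Type u} [CommRing R] [IsDomain R] [IsLocalRing R]
    (K : Type u) [Field K] [Algebra R K] [IsFractionRing R K] {X : Scheme.{u}}
    (f : X ⟶ Spec (.of R)) [AlgebraicGeometry.Smooth f] {g : ℕ}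
    (hg : topologicalKrullDim (genericFiber K f) = (g : WithBot ℕ∞)) {x : X}
    (c : CommRingCat.of R ⟶ X.presheaf.stalk x) (hc : Spec.map c = X.fromSpecStalk x ≫ f)
    (ζ : X.presheaf.stalk x ⟶ CommRingCat.of R) [IsLocalHom ζ.hom] (hζ : c ≫ ζ = 𝟙 _) :
    (∀ a, ∃ b, a - c b ∈ IsLocalRing.maximalIdeal (X.presheaf.stalk x)) ∧
    ∃ d ≤ g, ∃ t : Fin d → X.presheaf.stalk x, IsLocalRing.maximalIdeal (X.presheaf.stalk x) =
      (IsLocalRing.maximalIdeal R).map c.hom ⊔ Ideal.span (Set.range t) := by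
  have hζc : ∀ b, ζ (c b) = b := fun b => congr($hζ b)
  have hm : ∀ a, ζ a = 0 → a ∈ IsLocalRing.maximalIdeal (X.presheaf.stalk x) := fun a ha => by
    rw [IsLocalRing.mem_maximalIdeal]
    intro hu
    have := hu.map ζ.hom
    rw [ha] at this
    exact not_isUnit_zero this
  have hsub : ∀ a, a - c (ζ a) ∈ IsLocalRing.maximalIdeal (X.presheaf.stalk x) := fun a =>
    hm _ (by rw [map_sub, hζc, sub_self])
  refine ⟨fun a => ⟨ζ a, hsub a⟩, ?_⟩
  obtain ⟨n, E, _, _, _, _, _, j, hj, hxj, hjf⟩ := exists_standardEtale_chart f x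
  obtain ⟨ε, hε, hmax⟩ := exists_chart_to_stalk
    (CommRingCat.ofHom (algebraMap (MvPolynomial (Fin n) R) E))
    (by rw [CommRingCat.hom_ofHom, RingHom.etale_algebraMap]; infer_instance) j hxj
  have hcε : CommRingCat.ofHom (algebraMap R E) ≫ ε = c := by
    apply Spec.map_injective
    rw [hc, ← hε, Category.assoc, hjf, ← Spec.map_comp]
  let ζE : E →ₐ[R] R :=
    { (ζ.hom.comp ε.hom) with
      commutes' := fun b => by
        have : ζ ((CommRingCat.ofHom (algebraMap R E) ≫ ε) b) = b := by rw [hcε, hζc]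
        exact this }
  have hng := natCast_le_topologicalKrullDim_genericFiber K f (n := n) j hjf ζE
  rw [hg] at hng
  let θ : MvPolynomial (Fin n) R →+* X.presheaf.stalk x :=
    (CommRingCat.ofHom (algebraMap (MvPolynomial (Fin n) R) E) ≫ ε).hom
  have hθC : ∀ b, θ (MvPolynomial.C b) = c b := fun b => by
    rw [← hcε]
    change ε (algebraMap _ E (MvPolynomial.C b)) = ε (algebraMap R E b)
    rw [IsScalarTower.algebraMap_apply R (MvPolynomial (Fin n) R) E, MvPolynomial.algebraMap_eq]
  let b : Fin n → R := fun i => ζ (θ (MvPolynomial.X i))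
  let t : Fin n → X.presheaf.stalk x := fun i => θ (MvPolynomial.X i) - c (b i)
  have ht : ∀ i, t i ∈ IsLocalRing.maximalIdeal (X.presheaf.stalk x) := fun i => hsub _
  have hcm : ∀ r ∈ IsLocalRing.maximalIdeal R,
      c r ∈ IsLocalRing.maximalIdeal (X.presheaf.stalk x) := fun r hr => by
    rw [IsLocalRing.mem_maximalIdeal]
    intro hu
    have := hu.map ζ.hom
    rw [show ζ.hom (c r) = r from hζc r] at this
    exact (IsLocalRing.mem_maximalIdeal _).1 hr this
  let J := (IsLocalRing.maximalIdeal R).map c.hom ⊔ Ideal.span (Set.range t)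
  have hJ : J ≤ IsLocalRing.maximalIdeal (X.presheaf.stalk x) := by
    refine sup_le (Ideal.map_le_iff_le_comap.2 hcm) (Ideal.span_le.2 ?_)
    rintro _ ⟨i, rfl⟩
    exact ht i
  -- modulo `J`, a polynomial in the coordinates is congruent to its value at `b`
  have hcongr : ∀ P, θ P - c (MvPolynomial.eval b P) ∈ J := fun P => by
    rw [← Ideal.Quotient.eq]
    change ((Ideal.Quotient.mk J).comp θ) P =
      (((Ideal.Quotient.mk J).comp c.hom).comp (MvPolynomial.eval b)) P
    congr 1
    refine MvPolynomial.ringHom_ext (fun r => ?_) fun i => ?_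
    · simp only [RingHom.comp_apply, hθC, MvPolynomial.eval_C]
    · simp only [RingHom.comp_apply, MvPolynomial.eval_X]
      rw [Ideal.Quotient.eq]
      exact Ideal.mem_sup_right (Ideal.subset_span ⟨i, rfl⟩)
  refine ⟨n, by exact_mod_cast hng, t, le_antisymm ?_ hJ⟩
  rw [hmax, Ideal.map_le_iff_le_comap]
  intro P hP
  have hPc : c (MvPolynomial.eval b P) ∈ IsLocalRing.maximalIdeal (X.presheaf.stalk x) := by
    have hθP : θ P ∈ IsLocalRing.maximalIdeal (X.presheaf.stalk x) := hP
    have := Ideal.sub_mem _ hθP (hJ (hcongr P))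
    rwa [sub_sub_cancel] at this
  have hPm : MvPolynomial.eval b P ∈ IsLocalRing.maximalIdeal R := by
    rw [IsLocalRing.mem_maximalIdeal]
    exact fun hu => (IsLocalRing.mem_maximalIdeal _).1 hPc (hu.map c.hom)
  have := Ideal.add_mem J (hcongr P) (Ideal.mem_sup_left (Ideal.mem_map_of_mem c.hom hPm))
  rwa [sub_add_cancel] at this

end Cotangent

/-! ### Density of the integral points in a residue disc -/

section DensityOfSections

/-- Near a smooth point of the generic fiber coming from an integral point `β`, an integral scheme
`Y` receives a flat map from a standard étale algebra over a polynomial ring over `K`, compatibly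
with the point. -/
theorem exists_flat_chart_of_smoothAt {R : Type u} [CommRing R] [IsDomain R] [IsLocalRing R]
    (K : Type u) [Field K] [Algebra R K] [IsFractionRing R K] {Y : Scheme.{u}}
    (φ : Y ⟶ Spec (.of R)) (β : Spec (.of R) ⟶ Y) (hβ : β ≫ φ = 𝟙 _)
    (hsm : SmoothAt (genericFiberMap K φ) (genericPointOf K φ β hβ)) {U : Y.Opens}
    (hU : IsAffineOpen U) {s : CommRingCat.of R ⟶ Γ(Y, U)} (hs : Spec.map s = hU.fromSpec ≫ φ)
    {b : Γ(Y, U) ⟶ CommRingCat.of R} (hb : Spec.map b ≫ hU.fromSpec = β) :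
    ∃ (n : ℕ) (E : Type u) (_ : CommRing E) (_ : Algebra K E)
      (_ : Algebra (MvPolynomial (Fin n) K) E) (_ : IsScalarTower K (MvPolynomial (Fin n) K) E)
      (_ : Algebra.IsStandardEtale (MvPolynomial (Fin n) K) E) (ι : Γ(Y, U) →+* E)
      (φ₀ : E →ₐ[K] K), ι.Flat ∧ (∀ c, ι (s c) = algebraMap K E (algebraMap R K c)) ∧
        ∀ c, φ₀ (ι c) = algebraMap R K (b c) := by
  obtain ⟨V, hηV, hV⟩ := hsm
  let ρ : CommRingCat.of R ⟶ CommRingCat.of K := CommRingCat.ofHom (algebraMap R K)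
  have hρ : Flat (Spec.map ρ) := by
    rw [Flat.SpecMap_iff]
    change (algebraMap R K).Flat
    rw [RingHom.flat_algebraMap_iff]
    exact IsLocalization.flat K (nonZeroDivisors R)
  let F : genericFiber K φ ⟶ Y := pullback.fst φ (Spec.map ρ)
  let σ : Spec (.of K) ⟶ genericFiber K φ := genericSection K φ β hβ
  have hσF : σ ≫ F = Spec.map ρ ≫ β := pullback.lift_fst _ _ _
  have hσs : σ ≫ genericFiberMap K φ = 𝟙 _ := pullback.lift_snd _ _ _
  have hFs : F ≫ φ = genericFiberMap K φ ≫ Spec.map ρ := pullback.condition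
  let η : genericFiber K φ := genericPointOf K φ β hβ
  have hηU : F η ∈ U := by
    have h1 : F η = (σ ≫ F) (IsLocalRing.closedPoint K) := (Scheme.Hom.comp_apply _ _ _).symm
    have h2 : F η ∈ Set.range hU.fromSpec := by
      rw [h1, hσF, ← hb, ← Category.assoc]
      exact ⟨_, (Scheme.Hom.comp_apply _ _ _).symm⟩
    rwa [hU.range_fromSpec] at h2
  let V' : (genericFiber K φ).Opens := V ⊓ F ⁻¹ᵁ U
  have hηV' : η ∈ V' := ⟨hηV, hηU⟩
  have hsmV' : AlgebraicGeometry.Smooth (V'.ι ≫ genericFiberMap K φ) := by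
    have : V'.ι = (genericFiber K φ).homOfLE inf_le_left ≫ V.ι := by simp [V']
    rw [this, Category.assoc]
    infer_instance
  obtain ⟨n, E, _, _, _, _, hE, j, hj, hxj, hjf⟩ :=
    exists_standardEtale_chart (V'.ι ≫ genericFiberMap K φ) ⟨η, hηV'⟩
  let u : Spec (.of E) ⟶ Y := (j ≫ V'.ι) ≫ F
  have hFflat : Flat F := inferInstanceAs (Flat (pullback.fst φ (Spec.map ρ)))
  have hu : Flat u := inferInstance
  have huU : Set.range u ⊆ U := by
    rintro _ ⟨q, rfl⟩
    change ((j ≫ V'.ι) ≫ F) q ∈ U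
    rw [Scheme.Hom.comp_apply, Scheme.Hom.comp_apply]
    exact (j q).2.2
  obtain ⟨ι, hι, hιflat⟩ := exists_specMap_fromSpec hU u huU
  have hcl : σ (IsLocalRing.closedPoint K) ∈ Set.range (j ≫ V'.ι) := by
    obtain ⟨q, hq⟩ := hxj
    refine ⟨q, ?_⟩
    rw [Scheme.Hom.comp_apply, hq]
    rfl
  obtain ⟨w, hw⟩ := exists_factor_of_closedPoint_mem σ (j ≫ V'.ι) hcl
  obtain ⟨φ₀, rfl⟩ := Spec.map_surjective w
  have hφ₀ : CommRingCat.ofHom (algebraMap K E) ≫ φ₀ = 𝟙 _ := by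
    apply Spec.map_injective
    rw [Spec.map_comp, ← hjf, ← Category.assoc, ← Category.assoc, Category.assoc (Spec.map φ₀), hw,
      hσs, Spec.map_id]
  have hsι : s ≫ ι = ρ ≫ CommRingCat.ofHom (algebraMap K E) := by
    apply Spec.map_injective
    rw [Spec.map_comp, Spec.map_comp, hs, ← Category.assoc, hι, Category.assoc, hFs, ← hjf]
    simp only [Category.assoc]
  have hιφ : ι ≫ φ₀ = b ≫ ρ := by
    apply Spec.map_injective
    rw [← cancel_mono hU.fromSpec, Spec.map_comp, Spec.map_comp, Category.assoc, Category.assoc,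
      hι, hb, ← Category.assoc, hw, hσF]
  exact ⟨n, E, _, _, _, ‹_›, hE, ι.hom, { φ₀.hom with commutes' := fun c => congr($hφ₀ c) },
    hιflat hu, fun c => congr($hsι c), fun c => congr($hιφ c)⟩

/-- A flat ring homomorphism preserves nonzerodivisors. -/
theorem map_mem_nonZeroDivisors_of_flat {C E : Type*} [CommRing C] [CommRing E] {ι : C →+* E}
    (hι : ι.Flat) {h : C} (hh : h ∈ nonZeroDivisors C) : ι h ∈ nonZeroDivisors E := by
  algebraize [ι]
  have h1 : IsSMulRegular E h := Module.Flat.isSMulRegular_of_nonZeroDivisors hh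
  rw [mem_nonZeroDivisors_iff_right]
  intro x hx
  refine h1 ?_
  change h • x = h • (0 : E)
  rw [smul_zero, Algebra.smul_def, mul_comm]
  exact hx

variable (p : ℕ) [Fact p.Prime] (K : Type u) [Field K] [Algebra ℚ_[p] K]
  [FiniteDimensional ℚ_[p] K] [Algebra ℤ_[p] K] [IsScalarTower ℤ_[p] ℚ_[p] K]

/-- The integral points in the residue disc of an integral point that is smooth on the generic
fiber are Zariski dense. -/
theorem exists_section_mem_open {Y : Scheme.{u}} [AlgebraicGeometry.IsIntegral Y]
    (φ : Y ⟶ Spec (.of (integralClosure ℤ_[p] K))) [LocallyOfFiniteType φ]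
    (β : Spec (.of (integralClosure ℤ_[p] K)) ⟶ Y) (hβ : β ≫ φ = 𝟙 _)
    (hsm : SmoothAt (genericFiberMap K φ) (genericPointOf K φ β hβ))
    {W : Set Y} (hWo : IsOpen W) (hW : W.Nonempty) :
    ∃ y : Spec (.of (integralClosure ℤ_[p] K)) ⟶ Y, y ≫ φ = 𝟙 _ ∧
      y (IsLocalRing.closedPoint _) = β (IsLocalRing.closedPoint _) ∧
      y (⊥ : PrimeSpectrum (integralClosure ℤ_[p] K)) ∈ W := by
  obtain ⟨_, ⟨U, hU, rfl⟩, hβU, -⟩ := Y.isBasis_affineOpens.exists_subset_of_mem_open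
    (Set.mem_univ (β (IsLocalRing.closedPoint _))) isOpen_univ
  replace hU : IsAffineOpen U := hU
  obtain ⟨w, hw⟩ := exists_factor_of_closedPoint_mem β hU.fromSpec
    (by rw [hU.range_fromSpec]; exact hβU)
  obtain ⟨b, rfl⟩ := Spec.map_surjective w
  obtain ⟨s, hs⟩ := Spec.map_surjective (hU.fromSpec ≫ φ)
  have : IsFractionRing (integralClosure ℤ_[p] K) K :=
    integralClosure.isFractionRing_of_finite_extension ℚ_[p] K
  obtain ⟨n, E, _, _, _, _, _, ι, φ₀, hflat, hι, hιφ⟩ :=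
    exists_flat_chart_of_smoothAt K φ β hβ hsm hU hs hw
  have hft : LocallyOfFiniteType (Spec.map s) := hs ▸ inferInstance
  rw [HasRingHomProperty.Spec_iff (P := @LocallyOfFiniteType)] at hft
  let _ : Algebra (integralClosure ℤ_[p] K) Γ(Y, U) := s.hom.toAlgebra
  have : Algebra.FiniteType (integralClosure ℤ_[p] K) Γ(Y, U) := hft
  have : Nonempty U := ⟨⟨_, hβU⟩⟩
  have hsb : s ≫ b = 𝟙 _ := by
    apply Spec.map_injective
    rw [Spec.map_comp, hs, ← Category.assoc, hw, hβ, Spec.map_id]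
  let β' : Γ(Y, U) →ₐ[integralClosure ℤ_[p] K] integralClosure ℤ_[p] K :=
    { b.hom with commutes' := fun c => congr($hsb c) }
  -- a basic open subset of the chart inside `W`
  obtain ⟨v, hvU, hvW⟩ : ((U : Set Y) ∩ W).Nonempty :=
    nonempty_preirreducible_inter U.2 hWo ⟨_, hβU⟩ hW
  have hvr : v ∈ Set.range hU.fromSpec := by rw [hU.range_fromSpec]; exact hvU
  obtain ⟨q, hq⟩ := hvr
  have hWo' : IsOpen (hU.fromSpec ⁻¹' W) := hWo.preimage hU.fromSpec.continuous
  have hqW : hU.fromSpec q ∈ W := hq.symm ▸ hvW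
  obtain ⟨_, ⟨_, ⟨h, rfl⟩, rfl⟩, hqh, hhW⟩ :=
    PrimeSpectrum.isBasis_basic_opens.exists_subset_of_mem_open hqW hWo'
  have hh0 : h ≠ 0 := fun h0 => hqh (h0 ▸ q.asIdeal.zero_mem)
  obtain ⟨y, hy, hyh⟩ := exists_integral_point_ringOfIntegers p K
    (Algebra.IsStandardEtale.nonempty_standardEtalePresentation
      (R := MvPolynomial (Fin n) K) (S := E)).some ι hι φ₀ β' hιφ
    (map_mem_nonZeroDivisors_of_flat hflat (mem_nonZeroDivisors_of_ne_zero hh0))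
  let y' : Γ(Y, U) ⟶ CommRingCat.of (integralClosure ℤ_[p] K) := CommRingCat.ofHom y.toRingHom
  refine ⟨Spec.map y' ≫ hU.fromSpec, ?_, ?_, ?_⟩
  · rw [Category.assoc, ← hs, ← Spec.map_comp, ← Spec.map_id]
    congr 1
    ext c
    exact congrArg Subtype.val (y.commutes c)
  · rw [← hw]
    refine (Scheme.Hom.comp_apply _ _ _).trans (Eq.trans (congrArg _ ?_)
      (Scheme.Hom.comp_apply _ _ _).symm)
    refine PrimeSpectrum.ext (Ideal.ext fun c => ?_)
    change y c ∈ IsLocalRing.maximalIdeal _ ↔ b c ∈ IsLocalRing.maximalIdeal _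
    have : y c - b c ∈ IsLocalRing.maximalIdeal _ := hy c
    constructor <;> intro h
    · have h' := Ideal.sub_mem _ h this
      rwa [sub_sub_cancel] at h'
    · have h' := Ideal.add_mem _ this h
      rwa [sub_add_cancel] at h'
  · have h1 : hU.fromSpec (Spec.map y' (⊥ : PrimeSpectrum (integralClosure ℤ_[p] K))) ∈ W :=
      hhW hyh
    exact (Scheme.Hom.comp_apply (Spec.map y') hU.fromSpec
      (⊥ : PrimeSpectrum (integralClosure ℤ_[p] K))).symm ▸ h1

end DensityOfSections

/-! ### Dynamics on generic points -/

section TopologicalDynamics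

theorem iterate_add_mul_eq_of_periodic {X : Type*} {F : X → X} {η : X} {ℓ N : ℕ}
    (h : F^[ℓ + N] η = F^[ℓ] η) (k j : ℕ) :
    F^[ℓ + k + N * j] η = F^[ℓ + k] η := by
  have h1 : ∀ k, F^[ℓ + k + N] η = F^[ℓ + k] η := fun k => by
    rw [show ℓ + k + N = k + (ℓ + N) by ring, Function.iterate_add_apply, h,
      ← Function.iterate_add_apply, add_comm k]
  induction j with
  | zero => rfl
  | succ j ih =>
    rw [← ih, show ℓ + k + N * (j + 1) = ℓ + (k + N * j) + N by ring, h1, add_assoc]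

variable {X : Type*} [TopologicalSpace X] {F : X → X}

/-- Let `η` be preperiodic under a continuous map `F` with discrete fibers, and suppose that for a
set of points which is dense in the closure of `η`, the return of the orbit along `n ↦ a + M n` to
a closed set infinitely often implies that it stays there. Then `M` is a period of `η` from the
time `a` on. -/
theorem iterate_eq_of_forall_return [T0Space X] (hF : Continuous F)
    (hdisc : ∀ n y, _root_.IsDiscrete (F^[n] ⁻¹' {y})) {η : X} {ℓ N : ℕ} (hN : 0 < N)
    (hη : F^[ℓ + N] η = F^[ℓ] η) {D : Set X} (hηD : ∀ d ∈ D, η ⤳ d)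
    (hD : ∀ W, IsOpen W → η ∈ W → (W ∩ D).Nonempty) {a M : ℕ}
    (hret : ∀ d ∈ D, ∀ Z, IsClosed Z → {n : ℕ | F^[a + M * n] d ∈ Z}.Infinite →
      ∀ n, F^[a + M * n] d ∈ Z) : F^[a + M] η = F^[a] η := by
  rcases Nat.eq_zero_or_pos M with rfl | hM
  · rfl
  have hcont : ∀ n, Continuous F^[n] := fun n => hF.iterate n
  -- a time `a + M n₀` in the periodic part of the orbit, with `N ∣ n₀`
  obtain ⟨n₀, hn₀, hle⟩ : ∃ n₀, N ∣ n₀ ∧ ℓ ≤ a + M * n₀ :=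
    ⟨N * ℓ, dvd_mul_right _ _, (Nat.le_mul_of_pos_left ℓ (Nat.mul_pos hM hN)).trans
      (by rw [mul_assoc]; exact Nat.le_add_left _ _)⟩
  let ω : X := F^[a + M * n₀] η
  have hper : ∀ j, F^[a + M * (n₀ + N * j)] η = ω := fun j => by
    obtain ⟨k, hk⟩ := Nat.exists_eq_add_of_le hle
    have := iterate_add_mul_eq_of_periodic hη k (M * j)
    rw [← hk] at this
    rwa [show a + M * (n₀ + N * j) = a + M * n₀ + N * (M * j) by ring]
  -- the orbit of every point of `D` stays in the closure of `ω`
  have hDω : ∀ d ∈ D, ∀ n, ω ⤳ F^[a + M * n] d := fun d hd n => by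
    rw [specializes_iff_mem_closure]
    refine hret d hd _ isClosed_closure ?_ n
    refine Set.infinite_of_injective_forall_mem (f := fun j => n₀ + N * j)
      (fun j j' h => Nat.eq_of_mul_eq_mul_left hN (Nat.add_left_cancel h)) fun j => ?_
    have := (hηD d hd).map (hcont (a + M * (n₀ + N * j)))
    rw [hper] at this
    exact this.mem_closure
  have hηω : ∀ n, ω ⤳ F^[a + M * n] η := fun n => by
    rw [specializes_iff_mem_closure]
    by_contra hnot
    obtain ⟨d, hdW, hd⟩ := hD ((F^[a + M * n]) ⁻¹' (closure {ω})ᶜ)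
      (isClosed_closure.isOpen_compl.preimage (hcont _)) hnot
    exact hdW (hDω d hd n).mem_closure
  -- `ω` and its specialization `F^[a] η` lie in the same fiber
  have hωa : ω = F^[a] η := by
    obtain ⟨j, rfl⟩ := hn₀
    have h0 := hηω 0
    rw [mul_zero, add_zero] at h0
    refine (hdisc (M * (N * j)) ω).eq_of_specializes h0 ?_ ?_
    · change F^[M * (N * j)] (F^[a + M * (N * j)] η) = ω
      rw [← Function.iterate_add_apply,
        show M * (N * j) + (a + M * (N * j)) = a + M * (N * j + N * j) by ring, hper]
    · change F^[M * (N * j)] (F^[a] η) = ω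
      rw [← Function.iterate_add_apply, add_comm]
  -- `F^[a] η` specializes to its iterates under `F^[M]`, which come back to it
  have hstep : F^[a] η ⤳ F^[a + M] η := by
    have := hηω 1
    rwa [hωa, mul_one] at this
  have hchain : ∀ k, F^[a + M] η ⤳ F^[a + M * (k + 1)] η := fun k => by
    induction k with
    | zero => rw [zero_add, mul_one]
    | succ k ih =>
      refine ih.trans ?_
      have := hstep.map (hcont (M * (k + 1)))
      rwa [← Function.iterate_add_apply, ← Function.iterate_add_apply,
        show M * (k + 1) + a = a + M * (k + 1) by ring,
        show M * (k + 1) + (a + M) = a + M * (k + 1 + 1) by ring] at this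
  have hback : F^[a + M] η ⤳ F^[a] η := by
    have := hchain (n₀ + N * 1 - 1)
    rwa [Nat.sub_add_cancel (by omega), hper, hωa] at this
  exact (hback.antisymm hstep).eq

/-- The orbit of a point that satisfies `F^[a + M] η = F^[a] η` has at most `a + M` elements. -/
theorem encard_range_closure_iterate_le {η : X} {a M : ℕ} (hM : 0 < M)
    (h : F^[a + M] η = F^[a] η) :
    (Set.range fun n => closure {F^[n] η}).encard ≤ (a + M : ℕ) := by
  have hsmall : ∀ n, ∃ m < a + M, F^[m] η = F^[n] η := fun n => by
    induction n using Nat.strong_induction_on with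
    | _ n ih =>
      by_cases hn : n < a + M
      · exact ⟨n, hn, rfl⟩
      · obtain ⟨k, rfl⟩ := Nat.exists_eq_add_of_le (not_lt.1 hn)
        obtain ⟨m, hm, hmk⟩ := ih (a + k) (by omega)
        refine ⟨m, hm, hmk.trans ?_⟩
        rw [add_comm a k, add_comm (a + M) k, Function.iterate_add_apply, ← h,
          ← Function.iterate_add_apply]
  have hsub : (Set.range fun n => closure {F^[n] η}) ⊆
      (fun n => closure {F^[n] η}) '' (Finset.range (a + M) : Set ℕ) := by
    rintro _ ⟨n, rfl⟩
    obtain ⟨m, hm, hmn⟩ := hsmall n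
    exact ⟨m, by simpa using hm, by simp only [hmn]⟩
  refine (Set.encard_le_encard hsub).trans ((Set.encard_image_le _ _).trans ?_)
  rw [Set.encard_coe_eq_coe_finsetCard, Finset.card_range]

end TopologicalDynamics

section SchemeDynamics

/-- Étale morphisms have discrete fibers. -/
theorem isDiscrete_preimage_of_etale {X Y : Scheme.{u}} (f : X ⟶ Y) [AlgebraicGeometry.Etale f]
    (y : Y) : _root_.IsDiscrete (f ⁻¹' {y}) := by
  have : LocallyQuasiFinite f := by
    refine ⟨fun hU _ hV e => ?_⟩
    have h := HasRingHomProperty.appLE @AlgebraicGeometry.Etale f inferInstance ⟨_, hU⟩ ⟨_, hV⟩ e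
    algebraize [(f.appLE _ _ e).hom]
    exact inferInstanceAs (Algebra.QuasiFinite _ _)
  exact f.isDiscrete_preimage_singleton y

/-- The iterates of an endomorphism of a scheme. -/
def iterateHom {X : Scheme.{u}} (Φ : X ⟶ X) : ℕ → (X ⟶ X)
  | 0 => 𝟙 X
  | n + 1 => iterateHom Φ n ≫ Φ

theorem iterateHom_apply {X : Scheme.{u}} (Φ : X ⟶ X) (n : ℕ) (x : X) :
    iterateHom Φ n x = (fun x : X => Φ x)^[n] x := by
  induction n with
  | zero => rfl
  | succ n ih => rw [Function.iterate_succ_apply', ← ih]; exact Scheme.Hom.comp_apply _ _ _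

instance etale_iterateHom {X : Scheme.{u}} (Φ : X ⟶ X) [AlgebraicGeometry.Etale Φ] (n : ℕ) :
    AlgebraicGeometry.Etale (iterateHom Φ n) := by
  induction n with
  | zero => exact inferInstanceAs (AlgebraicGeometry.Etale (𝟙 X))
  | succ n ih => exact inferInstanceAs (AlgebraicGeometry.Etale (iterateHom Φ n ≫ Φ))

theorem iterateHom_comp {X S : Scheme.{u}} {Φ : X ⟶ X} {f : X ⟶ S} (h : Φ ≫ f = f) (n : ℕ) :
    iterateHom Φ n ≫ f = f := by
  induction n with
  | zero => exact Category.id_comp f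
  | succ n ih => rw [iterateHom, Category.assoc, h, ih]

/-- The iterates of the closure of a point are the closures of its iterates. -/
theorem iterImage_eq_closure {X : Scheme.{u}} (Φ : X ⟶ X) {S : Set X} {η : X}
    (hη : S = closure {η}) (n : ℕ) :
    iterImage Φ S n = closure {(fun x : X => Φ x)^[n] η} := by
  rw [iterImage, hη, closure_image_closure (Φ.continuous.iterate n), Set.image_singleton]

end SchemeDynamics

/-! ### Return times of integral points -/

section ReturnTimes

/-- The powers of an endomorphism of the stalk at a fixed point induce the iterates of the
endomorphism of the scheme. -/
theorem exists_hom_eq_pow_stalk {X : Scheme.{u}} {R : Type*} [CommRing R] {Ψ : X ⟶ X} {x : X}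
    [Algebra R (X.presheaf.stalk x)] {ψ : X.presheaf.stalk x ⟶ X.presheaf.stalk x}
    (hψ : Spec.map ψ ≫ X.fromSpecStalk x = X.fromSpecStalk x ≫ Ψ)
    {L : Module.End R (X.presheaf.stalk x)} (hL : ∀ a, L a = ψ a) (k : ℕ) :
    ∃ χ : X.presheaf.stalk x ⟶ X.presheaf.stalk x, (∀ a, χ a = (L ^ k) a) ∧
      Spec.map χ ≫ X.fromSpecStalk x = X.fromSpecStalk x ≫ iterateHom Ψ k := by
  induction k with
  | zero => exact ⟨𝟙 _, fun a => rfl, by rw [Spec.map_id]; simp [iterateHom]⟩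
  | succ k ih =>
    obtain ⟨χ, h1, h2⟩ := ih
    refine ⟨ψ ≫ χ, fun a => ?_, ?_⟩
    · rw [pow_succ, Module.End.mul_apply, hL]
      exact h1 (ψ a)
    · rw [Spec.map_comp, Category.assoc, hψ, ← Category.assoc, h2, Category.assoc]
      rfl

/-- Whether a point given by a homomorphism on a local ring lies in a closed set is decided by the
vanishing of the homomorphism on an ideal. -/
theorem exists_ideal_forall_mem_iff {X : Scheme.{u}} {A : CommRingCat.{u}} (q : Spec A ⟶ X)
    {Z : Set X} (hZ : IsClosed Z) : ∃ I : Ideal A, ∀ (R : Type u) [CommRing R] [IsDomain R]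
      (ζ : A ⟶ CommRingCat.of R),
        (Spec.map ζ ≫ q) (⊥ : PrimeSpectrum R) ∈ Z ↔ ∀ a ∈ I, ζ a = 0 := by
  obtain ⟨I, hI⟩ := (PrimeSpectrum.isClosed_iff_zeroLocus_ideal _).1 (hZ.preimage q.continuous)
  refine ⟨I, fun R _ _ ζ => ?_⟩
  have h1 : (Spec.map ζ ≫ q) (⊥ : PrimeSpectrum R) ∈ Z ↔
      Spec.map ζ (⊥ : PrimeSpectrum R) ∈ PrimeSpectrum.zeroLocus (I : Set A) := by
    rw [← hI]
    exact iff_of_eq (congrArg (· ∈ Z) (Scheme.Hom.comp_apply _ _ _))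
  rw [h1]
  exact Iff.rfl

variable (p : ℕ) [Fact p.Prime] (K : Type u) [Field K] [Algebra ℚ_[p] K]
  [FiniteDimensional ℚ_[p] K] [Algebra ℤ_[p] K] [IsScalarTower ℤ_[p] ℚ_[p] K]

/-- For an étale endomorphism `Ψ` with a fixed point `x` in the special fiber, there is a number
`M` such that for every integral point through `x`, the orbit under `Ψ^M` of its generic point stays
in every closed set to which it returns infinitely often. -/
theorem exists_pow_forall_return {e r g : ℕ}
    (he : e = (IsLocalRing.maximalIdeal (integralClosure ℤ_[p] K)).ramificationIdx ℤ_[p])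
    (hr : e < 2 ^ r * (p - 1)) {X : Scheme.{u}} (f : X ⟶ Spec (.of (integralClosure ℤ_[p] K)))
    [AlgebraicGeometry.Smooth f]
    (hg : topologicalKrullDim (genericFiber K f) = (g : WithBot ℕ∞)) (Ψ : X ⟶ X)
    [AlgebraicGeometry.Etale Ψ] (hΨ : Ψ ≫ f = f) {x : X} (hx : Ψ x = x)
    (z : Spec (.of (integralClosure ℤ_[p] K)) ⟶ X) (hz : z ≫ f = 𝟙 _)
    (hzx : z (IsLocalRing.closedPoint _) = x) :
    ∃ N, 0 < N ∧
      N ≤ Nat.card (GL (Fin g) (IsLocalRing.ResidueField (integralClosure ℤ_[p] K))) ∧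
      ∀ y : Spec (.of (integralClosure ℤ_[p] K)) ⟶ X, y ≫ f = 𝟙 _ →
        y (IsLocalRing.closedPoint _) = x → ∀ Z, IsClosed Z →
          {n : ℕ | iterateHom Ψ (N * p ^ (1 + r) * n)
            (y (⊥ : PrimeSpectrum (integralClosure ℤ_[p] K))) ∈ Z}.Infinite →
          ∀ n, iterateHom Ψ (N * p ^ (1 + r) * n)
            (y (⊥ : PrimeSpectrum (integralClosure ℤ_[p] K))) ∈ Z := by
  have : IsFractionRing (integralClosure ℤ_[p] K) K :=
    integralClosure.isFractionRing_of_finite_extension ℚ_[p] K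
  obtain ⟨c, hc⟩ := Spec.map_surjective (X.fromSpecStalk x ≫ f)
  obtain ⟨ψ, hψ, hψm⟩ := exists_stalk_endomorphism Ψ hx
  have hsec : ∀ y : Spec (.of (integralClosure ℤ_[p] K)) ⟶ X, y ≫ f = 𝟙 _ →
      y (IsLocalRing.closedPoint _) = x →
      ∃ ζ : X.presheaf.stalk x ⟶ CommRingCat.of (integralClosure ℤ_[p] K),
        IsLocalHom ζ.hom ∧ Spec.map ζ ≫ X.fromSpecStalk x = y ∧ c ≫ ζ = 𝟙 _ := fun y hy hyx => by
    obtain ⟨ζ, hζ, hζy⟩ := exists_specMap_fromSpecStalk y hyx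
    refine ⟨ζ, hζ, hζy, ?_⟩
    apply Spec.map_injective
    rw [Spec.map_comp, hc, ← Category.assoc, hζy, hy, Spec.map_id]
  obtain ⟨ζz, hζz, -, hcz⟩ := hsec z hz hzx
  obtain ⟨hsurj, d, hdg, t, ht⟩ := exists_generators_maximalIdeal_stalk K f hg c hc ζz hcz
  let _ : Algebra (integralClosure ℤ_[p] K) (X.presheaf.stalk x) := c.hom.toAlgebra
  have hcl : IsLocalHom (algebraMap (integralClosure ℤ_[p] K) (X.presheaf.stalk x)) := by
    refine ⟨fun a ha => ?_⟩
    have h1 := ha.map ζz.hom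
    have h2 : ζz.hom (algebraMap (integralClosure ℤ_[p] K) (X.presheaf.stalk x) a) = a :=
      congr($hcz a)
    rwa [h2] at h1
  have hcψ : c ≫ ψ = c := by
    apply Spec.map_injective
    rw [Spec.map_comp, hc, ← Category.assoc, hψ, Category.assoc, hΨ]
  let ψ' : X.presheaf.stalk x →ₐ[integralClosure ℤ_[p] K] X.presheaf.stalk x :=
    { ψ.hom with commutes' := fun a => congr($hcψ a) }
  obtain ⟨N, hN0, hN, h⟩ := exists_pow_eval_eq_zero_ringOfIntegers p K he hr hsurj hdg ht
    (ψ := ψ') hψm.symm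
  refine ⟨N, hN0, hN, fun y hy hyx Z hZ hinf => ?_⟩
  obtain ⟨ζ, hζ, hζy, hcζ⟩ := hsec y hy hyx
  let ζ' : X.presheaf.stalk x →ₐ[integralClosure ℤ_[p] K] integralClosure ℤ_[p] K :=
    { ζ.hom with commutes' := fun a => congr($hcζ a) }
  obtain ⟨I, hI⟩ := exists_ideal_forall_mem_iff (X.fromSpecStalk x) hZ
  have key : ∀ n, iterateHom Ψ (N * p ^ (1 + r) * n)
      (y (⊥ : PrimeSpectrum (integralClosure ℤ_[p] K))) ∈ Z ↔
      ∀ a ∈ I, ζ' (((ψ'.toLinearMap ^ (N * p ^ (1 + r))) ^ n) a) = 0 := fun n => by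
    obtain ⟨χ, hχ, hχΨ⟩ := exists_hom_eq_pow_stalk hψ (L := ψ'.toLinearMap) (fun _ => rfl)
      (N * p ^ (1 + r) * n)
    have h1 : y ≫ iterateHom Ψ (N * p ^ (1 + r) * n) = Spec.map (χ ≫ ζ) ≫ X.fromSpecStalk x := by
      rw [Spec.map_comp, Category.assoc, hχΨ, ← Category.assoc, hζy]
    have h2 := hI _ (χ ≫ ζ)
    rw [← h1] at h2
    refine (iff_of_eq (congrArg (· ∈ Z) (Scheme.Hom.comp_apply _ _ _).symm)).trans (h2.trans ?_)
    refine forall₂_congr fun a _ => ?_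
    rw [← pow_mul, ← hχ]
    exact Iff.rfl
  simp only [key] at hinf ⊢
  refine fun n a ha => h ζ' hζ a (hinf.mono fun k hk => ?_) n
  exact (show ∀ a ∈ I, ζ' (((ψ'.toLinearMap ^ (N * p ^ (1 + r))) ^ k) a) = 0 from hk) a ha

end ReturnTimes

/-! ### The bound for the orbit length -/

section OrbitLength

/-- The point of the special fiber in which a section of `X` meets it. -/
noncomputable def specialSection {R : Type u} [CommRing R] [IsLocalRing R] {X : Scheme.{u}}
    (f : X ⟶ Spec (.of R)) (z : Spec (.of R) ⟶ X) (hz : z ≫ f = 𝟙 _) : SpecialFiberPoints f :=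
  ⟨pullback.lift (Spec.map (CommRingCat.ofHom (IsLocalRing.residue R)) ≫ z) (𝟙 _) (by simp [hz]),
    pullback.lift_snd _ _ _⟩

theorem closedPoint_eq_of_specialSection_eq {R : Type u} [CommRing R] [IsLocalRing R]
    {X : Scheme.{u}} {f : X ⟶ Spec (.of R)} {z z' : Spec (.of R) ⟶ X} {hz : z ≫ f = 𝟙 _}
    {hz' : z' ≫ f = 𝟙 _} (h : specialSection f z hz = specialSection f z' hz') :
    z (IsLocalRing.closedPoint R) = z' (IsLocalRing.closedPoint R) := by
  have h1 : Spec.map (CommRingCat.ofHom (IsLocalRing.residue R)) ≫ z =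
      Spec.map (CommRingCat.ofHom (IsLocalRing.residue R)) ≫ z' := by
    have h2 := congrArg (fun s : SpecialFiberPoints f => s.1 ≫ pullback.fst _ _) h
    simpa only [specialSection, pullback.lift_fst] using h2
  have h3 : Spec.map (CommRingCat.ofHom (IsLocalRing.residue R))
      (IsLocalRing.closedPoint (IsLocalRing.ResidueField R)) = IsLocalRing.closedPoint R :=
    IsLocalRing.comap_closedPoint (IsLocalRing.residue R)
  have h4 : ∀ w : Spec (.of R) ⟶ X, w (IsLocalRing.closedPoint R) =
      (Spec.map (CommRingCat.ofHom (IsLocalRing.residue R)) ≫ w)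
        (IsLocalRing.closedPoint (IsLocalRing.ResidueField R)) := fun w => by
    rw [← h3]
    exact (Scheme.Hom.comp_apply _ _ _).symm
  rw [h4 z, h4 z', h1]

/-- The condition on the exponent `r` says that `2 ^ r` exceeds `e / (p - 1)`. -/
theorem lt_two_pow_mul_of_log_lt {p e r : ℕ} (hp : 1 < p) (he : e ≠ 0)
    (hr : (Real.log e - Real.log ((p : ℝ) - 1)) / Real.log 2 < (r : ℝ)) :
    e < 2 ^ r * (p - 1) := by
  have hp1 : (0 : ℝ) < (p : ℝ) - 1 := by
    have : (1 : ℝ) < p := by exact_mod_cast hp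
    linarith
  have h2 : 0 < Real.log 2 := Real.log_pos one_lt_two
  rw [div_lt_iff₀ h2, sub_lt_iff_lt_add, ← Real.log_pow, ← Real.log_mul (by positivity) hp1.ne']
    at hr
  have he' : (0 : ℝ) < e := by exact_mod_cast Nat.pos_of_ne_zero he
  have h3 := (Real.log_lt_log_iff he' (by positivity)).1 hr
  have h4 : ((p - 1 : ℕ) : ℝ) = (p : ℝ) - 1 := by push_cast [Nat.cast_sub hp.le]; ring
  rw [← h4] at h3
  exact_mod_cast h3

end OrbitLength

end PadicOrbit

theorem theorem1p1 (p : ℕ) [Fact p.Prime]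
    -- a finite extension `K` of `ℚ_p`, with its ring of integers `integralClosure ℤ_[p] K`
    (K : Type u) [Field K] [Algebra ℚ_[p] K] [FiniteDimensional ℚ_[p] K]
    [Algebra ℤ_[p] K] [IsScalarTower ℤ_[p] ℚ_[p] K]
    -- its ramification index, and the exponent `r`
    (e : ℕ) (he : e = (IsLocalRing.maximalIdeal (integralClosure ℤ_[p] K)).ramificationIdx ℤ_[p])
    (r : ℕ)
    (hr : IsLeast {n : ℕ | (Real.log e - Real.log ((p : ℝ) - 1)) / Real.log 2 < (n : ℝ)} r)
    -- a smooth scheme `X` over the ring of integers with generic fiber of dimension `g`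
    (X : Scheme.{u}) (f : X ⟶ Spec (.of (integralClosure ℤ_[p] K))) [AlgebraicGeometry.Smooth f]
    (g : ℕ) (hg : topologicalKrullDim (PadicOrbit.genericFiber K f) = (g : WithBot ℕ∞))
    -- an étale endomorphism of `X` over the ring of integers
    (Φ : X ⟶ X) [AlgebraicGeometry.Etale Φ] (hΦ : Φ ≫ f = f)
    -- a subvariety `Y` of `X`
    (Y : Scheme.{u}) [AlgebraicGeometry.IsIntegral Y] (i : Y ⟶ X) [IsClosedImmersion i]
    -- an integral point of `Y` that is smooth on the generic fiber of `Y`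
    (β : Spec (.of (integralClosure ℤ_[p] K)) ⟶ Y) (hβ : β ≫ i ≫ f = 𝟙 _)
    (hsm : PadicOrbit.SmoothAt (PadicOrbit.genericFiberMap K (i ≫ f))
      (PadicOrbit.genericPointOf K (i ≫ f) β hβ))
    (hY : PadicOrbit.IsPreperiodic Φ (Set.range i)) :
    PadicOrbit.orbitLength Φ (Set.range i) ≤
      (p : ℕ∞) ^ (1 + r) *
        (Nat.card (GL (Fin g) (IsLocalRing.ResidueField (integralClosure ℤ_[p] K))) : ℕ∞) *
        ENat.card (PadicOrbit.SpecialFiberPoints f) := by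
  open PadicOrbit in
  have hp : 1 < p := (Fact.out : p.Prime).one_lt
  have hr' : e < 2 ^ r * (p - 1) :=
    lt_two_pow_mul_of_log_lt hp (exists_uniformizer p K he).1 hr.1
  have := finite_residueField_ringOfIntegers p K
  have hGL : 0 < Nat.card (GL (Fin g) (IsLocalRing.ResidueField (integralClosure ℤ_[p] K))) :=
    Nat.card_pos
  let F : X → X := fun x => Φ x
  -- the integral points `Φⁿ(β)` of `X`
  have hsec : ∀ (y : Spec (.of (integralClosure ℤ_[p] K)) ⟶ Y) (_ : y ≫ i ≫ f = 𝟙 _) (n : ℕ),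
      ((y ≫ i) ≫ iterateHom Φ n) ≫ f = 𝟙 _ := fun y hy n => by
    rw [Category.assoc, iterateHom_comp hΦ, Category.assoc, hy]
  have happ : ∀ (y : Spec (.of (integralClosure ℤ_[p] K)) ⟶ Y) (n : ℕ)
      (v : Spec (.of (integralClosure ℤ_[p] K))),
      ((y ≫ i) ≫ iterateHom Φ n) v = F^[n] (i (y v)) := fun y n v => by
    rw [Scheme.Hom.comp_apply, Scheme.Hom.comp_apply, iterateHom_apply]
  rcases finite_or_infinite (SpecialFiberPoints f) with hfin | hinf
  swap
  · rw [ENat.card_eq_top_of_infinite, ENat.mul_top]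
    · exact le_top
    · exact mul_ne_zero (pow_ne_zero _ (by exact_mod_cast (zero_lt_one.trans hp).ne'))
        (by exact_mod_cast hGL.ne')
  -- two among the first `#X̄(k) + 1` iterates of `β` have the same reduction
  obtain ⟨a, b, hb, hab, hred⟩ : ∃ a b, 0 < b ∧ a + b ≤ Nat.card (SpecialFiberPoints f) ∧
      F^[b] (F^[a] (i (β (IsLocalRing.closedPoint _)))) =
        F^[a] (i (β (IsLocalRing.closedPoint _))) := by
    have hninj : ¬ Function.Injective fun n : Fin (Nat.card (SpecialFiberPoints f) + 1) =>
        specialSection f _ (hsec β hβ n.val) := fun hinj => by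
      have := Nat.card_le_card_of_injective _ hinj
      simp at this
    obtain ⟨m, n, hmn, hlt⟩ : ∃ m n : Fin (Nat.card (SpecialFiberPoints f) + 1),
        specialSection f _ (hsec β hβ m.val) = specialSection f _ (hsec β hβ n.val) ∧ m < n := by
      simp only [Function.Injective, not_forall] at hninj
      obtain ⟨m, n, hmn, hne⟩ := hninj
      rcases lt_or_gt_of_ne hne with h | h
      · exact ⟨m, n, hmn, h⟩
      · exact ⟨n, m, hmn.symm, h⟩
    have hcl := closedPoint_eq_of_specialSection_eq hmn
    have hle : m.val ≤ n.val := (Fin.lt_def.1 hlt).le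
    refine ⟨m.val, n.val - m.val, Nat.sub_pos_of_lt hlt, ?_, ?_⟩
    · rw [Nat.add_sub_cancel' hle]
      exact Nat.lt_succ_iff.1 n.2
    · rw [← Function.iterate_add_apply, Nat.sub_add_cancel hle]
      exact (happ β n.val _).symm.trans (hcl.symm.trans (happ β m.val _))
  obtain ⟨N, hN0, hN, hret⟩ := exists_pow_forall_return p K he hr' f hg (iterateHom Φ b)
    (iterateHom_comp hΦ b) ((iterateHom_apply Φ b _).trans hred) _ (hsec β hβ a) (happ β a _)
  -- the generic point of `Y`
  have hη : Set.range i = closure {i (genericPoint Y)} := by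
    rw [← Set.image_singleton, ← closure_image_closure i.continuous, genericPoint_closure,
      Set.image_univ]
    exact (IsClosedImmersion.isClosedEmbedding i).isClosed_range.closure_eq.symm
  obtain ⟨ℓ, N', hN', hper⟩ := hY
  have hperη : F^[ℓ + N'] (i (genericPoint Y)) = F^[ℓ] (i (genericPoint Y)) := by
    rw [iterImage_eq_closure Φ hη, iterImage_eq_closure Φ hη] at hper
    exact (inseparable_iff_closure_eq.2 hper).eq
  have hcomp : ∀ n y, (iterateHom (iterateHom Φ b) n) y = F^[b * n] y := fun n y => by
    rw [iterateHom_apply, Function.iterate_mul]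
    congr 2
    funext x
    exact iterateHom_apply Φ b x
  have hmain : F^[a + b * (N * p ^ (1 + r))] (i (genericPoint Y)) = F^[a] (i (genericPoint Y)) := by
    refine iterate_eq_of_forall_return (D := {d | ∃ y : Spec (.of (integralClosure ℤ_[p] K)) ⟶ Y,
        y ≫ i ≫ f = 𝟙 _ ∧ y (IsLocalRing.closedPoint _) = β (IsLocalRing.closedPoint _) ∧
          i (y (⊥ : PrimeSpectrum (integralClosure ℤ_[p] K))) = d})
      Φ.continuous (fun n y => ?_) hN' hperη ?_ ?_ ?_
    · have h := isDiscrete_preimage_of_etale (iterateHom Φ n) y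
      rwa [show ⇑(iterateHom Φ n) = F^[n] from funext fun x => iterateHom_apply Φ n x] at h
    · rintro _ ⟨y, -, -, rfl⟩
      exact (genericPoint_specializes _).map i.continuous
    · intro W hW hηW
      obtain ⟨y, hy, hycl, hyW⟩ := exists_section_mem_open p K (i ≫ f) β hβ hsm
        (hW.preimage i.continuous) ⟨_, hηW⟩
      exact ⟨_, hyW, y, hy, hycl, rfl⟩
    · rintro _ ⟨y, hy, hycl, rfl⟩ Z hZ hinf n
      have hkey : ∀ n, iterateHom (iterateHom Φ b) (N * p ^ (1 + r) * n)
          (((y ≫ i) ≫ iterateHom Φ a) (⊥ : PrimeSpectrum (integralClosure ℤ_[p] K))) =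
          F^[a + b * (N * p ^ (1 + r)) * n]
            (i (y (⊥ : PrimeSpectrum (integralClosure ℤ_[p] K)))) := fun n => by
        refine (congrArg _ (happ y a _)).trans ?_
        rw [hcomp, ← Function.iterate_add_apply,
          show b * (N * p ^ (1 + r) * n) + a = a + b * (N * p ^ (1 + r)) * n by ring]
      have h := hret _ (hsec y hy a) ((happ y a _).trans (by rw [hycl])) Z hZ
      simp only [hkey] at h
      exact h hinf n
  have hM : 0 < b * (N * p ^ (1 + r)) :=
    Nat.mul_pos hb (Nat.mul_pos hN0 (pow_pos (zero_lt_one.trans hp) _))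
  have hlen := encard_range_closure_iterate_le hM hmain
  rw [orbitLength, show iterImage Φ (Set.range i) = fun n => closure {F^[n] (i (genericPoint Y))}
    from funext fun n => iterImage_eq_closure Φ hη n]
  refine hlen.trans ?_
  rw [ENat.card_eq_coe_natCard]
  have hfinal : a + b * (N * p ^ (1 + r)) ≤ p ^ (1 + r) *
      Nat.card (GL (Fin g) (IsLocalRing.ResidueField (integralClosure ℤ_[p] K))) *
      Nat.card (SpecialFiberPoints f) := by
    have h1 : 1 ≤ N * p ^ (1 + r) := Nat.mul_pos hN0 (pow_pos (zero_lt_one.trans hp) _)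
    calc a + b * (N * p ^ (1 + r)) ≤ (a + b) * (N * p ^ (1 + r)) := by
          rw [add_mul]; exact Nat.add_le_add_right (Nat.le_mul_of_pos_right a h1) _
      _ ≤ Nat.card (SpecialFiberPoints f) *
          (Nat.card (GL (Fin g) (IsLocalRing.ResidueField (integralClosure ℤ_[p] K))) *
            p ^ (1 + r)) := by gcongr
      _ = _ := by ring
  exact_mod_cast hfinal
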